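/- For a compactly supported probability measure $\mu$ on $\mathbb{R}$ let $G_\mu(z)=\int \frac{d\mu(t)}{z-t}$ be its Cauchy transform, and let $K_\mu$ be the functional inverse of $G_\mu$: $K_\mu(G_\mu(z))=z$ for all sufficiently large $z$, and $G_\mu(K_\mu(z))=z$ for all $z\neq 0$ near $0$. The free convolution $\mu_1\boxplus\mu_2$ is the compactly supported probability measure with $K_{\mu_1\boxplus\mu_2}(z)=K_{\mu_1}(z)+K_{\mu_2}(z)-\frac1z$ for all $z\ne0$ near $0$. Let $\nu$ be the standard semicircle law, with density $\frac1{2\pi}\sqrt{4-t^2}$ on $[-2,2]$, and for probability measures $\mu_1,\mu_2$ on $\mathbb{R}$ with distribution functions $F_1,F_2$ let $d(\mu_1,\mu_2)=\sup_{x\in\mathbb{R}}|F_1(x)-F_2(x)|$ be the Kolmogorov distance. Let $p,q>0$ with $p+q=1$ and $p\neq q$, and let $\mu$ be the probability measure with $\mu\{-1/p\}=p$ and $\mu\{1/q\}=q$, which has mean $0$ and variance $1/(pq)$. Set $\mu^{\boxplus 0}=\delta_0$ and $\mu^{\boxplus(n+1)}=\mu^{\boxplus n}\boxplus\mu$; for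 every $n\ge 0$ the free convolution $\mu^{\boxplus n}\boxplus\mu$ exists and is unique. For $n\ge1$ let $\mu^{(n)}$ be $\mu^{\boxplus n}$ rescaled to unit variance, that is, $\mu^{(n)}(B)=\mu^{\boxplus n}\bigl(\sqrt{n/(pq)}\,B\bigr)$ for Borel sets $B$. Then there are positive constants $C_1,C_2$, which may depend on $p$ but not on $n$, such that for every integer $n\ge 1$ $$C_1n^{-1/2}\le d\bigl(\mu^{(n)},\nu\bigr)\le C_2n^{-1/2}.$$ Thus the distance is exactly of order $n^{-1/2}$, and the rate $n^{-1/2}$ cannot be improved. -/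

import Mathlib

open MeasureTheory ProbabilityTheory Filter Topology

namespace FreeBerryEsseen

/-- The Cauchy transform `G_μ(z) = ∫ dμ(t) / (z - t)` of a measure on the real line. -/
noncomputable def cauchyTransform (μ : Measure ℝ) (z : ℂ) : ℂ :=
  ∫ t : ℝ, 1 / (z - (t : ℂ)) ∂μ

/-- `K` is a `K`-function of `μ`: a functional inverse of the Cauchy transform,
`K (G z) = z` for all sufficiently large `z` and `G (K z) = z` in a punctured neighborhood of `0`.
For a compactly supported probability measure this determines `K` near `0`. -/
def IsKFunction (μ : Measure ℝ) (K : ℂ → ℂ) : Prop :=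
  (∀ᶠ z in Bornology.cobounded ℂ, K (cauchyTransform μ z) = z) ∧
    ∀ᶠ z in 𝓝[≠] (0 : ℂ), cauchyTransform μ (K z) = z

/-- `μ` is a compactly supported probability measure on the real line. -/
def IsCompactProbability (μ : Measure ℝ) : Prop :=
  IsProbabilityMeasure μ ∧ IsCompact μ.support

/-- `μ₃` is the free additive convolution of `μ₁` and `μ₂`: all three are compactly supported
probability measures and their `K`-functions satisfy `K₃(z) = K₁(z) + K₂(z) - 1/z` near `0`. -/
def IsFreeConvolution (μ₁ μ₂ μ₃ : Measure ℝ) : Prop :=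
  IsCompactProbability μ₁ ∧ IsCompactProbability μ₂ ∧ IsCompactProbability μ₃ ∧
    ∃ K₁ K₂ K₃ : ℂ → ℂ, IsKFunction μ₁ K₁ ∧ IsKFunction μ₂ K₂ ∧ IsKFunction μ₃ K₃ ∧
      ∀ᶠ z in 𝓝[≠] (0 : ℂ), K₃ z = K₁ z + K₂ z - 1 / z

open Classical in
/-- The free additive convolution `μ₁ ⊞ μ₂` (the zero measure if there is none). -/
noncomputable def freeConvolution (μ₁ μ₂ : Measure ℝ) : Measure ℝ :=
  if h : ∃ μ₃, IsFreeConvolution μ₁ μ₂ μ₃ then h.choose else 0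

/-- The `n`-fold free convolution `μ ⊞ ⋯ ⊞ μ`; for `n = 0` it is `δ₀`, the unit of `⊞`. -/
noncomputable def freeConvolutionPower (μ : Measure ℝ) : ℕ → Measure ℝ
  | 0 => Measure.dirac 0
  | n + 1 => freeConvolution (freeConvolutionPower μ n) μ

/-- The two-point measure with mass `p` at `-1/p` and mass `q` at `1/q`. -/
noncomputable def twoPointMeasure (p q : ℝ) : Measure ℝ :=
  ENNReal.ofReal p • Measure.dirac (-1 / p) + ENNReal.ofReal q • Measure.dirac (1 / q)

/-- The `n`-fold free convolution of the two-point measure, rescaled to unit variance: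
`μ⁽ⁿ⁾(dx) = (μ ⊞ ⋯ ⊞ μ)(√(n / (p q)) dx)`. -/
noncomputable def normalizedPower (p q : ℝ) (n : ℕ) : Measure ℝ :=
  (freeConvolutionPower (twoPointMeasure p q) n).map (fun x => x / √(n / (p * q)))

/-- The standard semicircle law, with density `√(4 - t²) / (2π)` on `[-2, 2]`
(the real square root of a negative number is `0`). -/
noncomputable def semicircleLaw : Measure ℝ :=
  volume.withDensity (fun t => ENNReal.ofReal (√(4 - t ^ 2) / (2 * Real.pi)))

/-- The Kolmogorov distance between two probability measures on the real line. -/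
noncomputable def kolmogorovDist (μ ν : Measure ℝ) : ℝ :=
  ⨆ x : ℝ, |cdf μ x - cdf ν x|

instance isProbabilityMeasure_semicircleLaw : IsProbabilityMeasure semicircleLaw := by
  have hint : ∫ t in (-2 : ℝ)..2, √(4 - t ^ 2) / (2 * Real.pi) = 1 := by
    have h1 := intervalIntegral.integral_comp_mul_left
      (a := -1) (b := 1) (fun t : ℝ => √(4 - t ^ 2)) (two_ne_zero)
    have h2 : ∀ x : ℝ, √(4 - (2 * x) ^ 2) = 2 * √(1 - x ^ 2) := by
      intro x
      rw [show 4 - (2 * x) ^ 2 = 2 ^ 2 * (1 - x ^ 2) by ring,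
        Real.sqrt_mul (by norm_num), Real.sqrt_sq (by norm_num)]
    simp only [h2, intervalIntegral.integral_const_mul, integral_sqrt_one_sub_sq] at h1
    rw [intervalIntegral.integral_div]
    norm_num at h1
    rw [div_eq_one_iff_eq (by positivity)]
    linarith
  have hzero : ∀ t : ℝ, t ∉ Set.Ioc (-2 : ℝ) 2 → √(4 - t ^ 2) / (2 * Real.pi) = 0 := by
    intro t ht
    rw [Real.sqrt_eq_zero_of_nonpos, zero_div]
    by_contra! hc
    exact ht ⟨by nlinarith, by nlinarith⟩
  have hcont : Continuous (fun t : ℝ => √(4 - t ^ 2) / (2 * Real.pi)) := by fun_prop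
  have hfull : ∫ t : ℝ, √(4 - t ^ 2) / (2 * Real.pi) = 1 := by
    rw [← hint, intervalIntegral.integral_of_le (by norm_num)]
    exact (setIntegral_eq_integral_of_forall_compl_eq_zero hzero).symm
  have hI : Integrable (fun t : ℝ => √(4 - t ^ 2) / (2 * Real.pi)) := by
    by_contra h
    rw [integral_undef h] at hfull
    exact zero_ne_one hfull
  refine ⟨?_⟩
  rw [semicircleLaw, withDensity_apply _ MeasurableSet.univ, Measure.restrict_univ,
    ← ofReal_integral_eq_lintegral_ofReal hI (ae_of_all _ fun t => by positivity), hfull,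
    ENNReal.ofReal_one]

end FreeBerryEsseen

/-!
The free powers of the two-point measure are known explicitly, and both bounds are read off from the
explicit form.

Put `fₙ(ρ) = p q ρ / (1 - (q - p) ρ + (n - 1) p q ρ²)` (`binomialParam`). If `R` is the inverse of
`f₀` near `0`, then `R` is the `R`-transform of the two-point measure, and `1 / fₙ = 1 / f₀ + n ρ`.
So a compactly supported probability measure `μₙ` is the `n`-th free power as soon as
`G(1 / fₙ(ρ)) = f₀(ρ)` for small `ρ ≠ 0` (`HasBinomialTransform`): its `K`-function is then
`1 / w + n R(w)`. Uniqueness of free convolutions holds because the `K`-function near `0` determines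
the Cauchy transform near `∞`, hence all moments, hence the measure
(`eq_of_isKFunction_eventuallyEq`).

To construct `μₙ` for `n ≥ 2`, let `λ_β` (`spikedSemicircle`) be the semicircle law with the extra
density `1 / (1 + β² - β u)`, completed by an atom at `β + 1 / β` if `|β| > 1`. With `z = ζ + 1 / ζ`
the semicircle law has Cauchy transform `ζ`, and partial fractions give the transform
`ζ / (1 - β ζ)` for `λ_β` (`cauchyTransform_spikedSemicircle`). With `r² = (n - 1) / (p q)`, the
image of `p λ_{-1/(q r)} + q λ_{1/(p r)}` under `u ↦ r u - (q - p) / (p q)` has the required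
transform, as one sees by substituting `ζ = p q r ρ` (`cauchyTransform_freeBinomial`).

Upper bound: for large `n` both `β` are of order `n ^ (-1/2)`, there are no atoms, the extra
densities are `1 + O(|β|)`, and the affine change of variables normalizes to the identity up to
`O(n ^ (-1/2))`, which moves the Lipschitz distribution function of the semicircle law by as much.

Lower bound: to the right of the supports the difference of two Cauchy transforms is at most a
constant times the Kolmogorov distance (`abs_integral_sub_le_kolmogorovDist`). The transform `G` of
the rescaled power takes the value `w = τ / (1 - η)` at `1 / w + τ`, where `τ = 1 / 8` and `η` is of
exact order `(q - p) n ^ (-1/2)`, while the semicircle law satisfies `G + 1 / G = z`; the two values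
therefore differ by at least a constant times `|η|`. For the finitely many remaining `n` it is
enough that the rescaled power is not the semicircle law.
-/

open MeasureTheory ProbabilityTheory Filter Topology

namespace FreeBerryEsseen

/-! ### Integration against the semicircle law -/

section Semicircle

variable {E : Type*} [NormedAddCommGroup E] [NormedSpace ℝ E]

theorem image_two_mul_cos : (fun θ : ℝ => 2 * Real.cos θ) ''
    Set.Ioo 0 Real.pi = Set.Ioo (-2) 2 := by
  ext x
  constructor
  · rintro ⟨θ, hθ, rfl⟩
    have h1 := Real.cos_lt_cos_of_nonneg_of_le_pi (le_refl 0) hθ.2.le hθ.1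
    have h2 := Real.cos_lt_cos_of_nonneg_of_le_pi hθ.1.le le_rfl hθ.2
    simp only [Real.cos_zero, Real.cos_pi] at h1 h2
    constructor <;> dsimp only <;> linarith
  · intro hx
    refine ⟨Real.arccos (x / 2), ⟨Real.arccos_pos.2 (by linarith [hx.2]),
      lt_of_le_of_ne (Real.arccos_le_pi _) fun h => ?_⟩, ?_⟩
    · have := Real.arccos_eq_pi.1 h
      linarith [hx.1]
    · dsimp only
      rw [Real.cos_arccos (by linarith [hx.1]) (by linarith [hx.2])]
      ring

theorem injOn_two_mul_cos : Set.InjOn (fun θ : ℝ => 2 * Real.cos θ) (Set.Ioo 0 Real.pi) := by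
  intro x hx y hy h
  exact Real.injOn_cos ⟨hx.1.le, hx.2.le⟩ ⟨hy.1.le, hy.2.le⟩ (by simpa using h)

theorem hasDerivWithinAt_two_mul_cos (x : ℝ) :
    HasDerivWithinAt (fun θ : ℝ => 2 * Real.cos θ) (-2 * Real.sin x) (Set.Ioo 0 Real.pi) x := by
  have := ((Real.hasDerivAt_cos x).const_mul 2).hasDerivWithinAt (s := Set.Ioo 0 Real.pi)
  simpa [neg_mul] using this

theorem semicircle_jacobian {θ : ℝ} (hθ : θ ∈ Set.Ioo 0 Real.pi) :
    |(-2) * Real.sin θ| * (√(4 - (2 * Real.cos θ) ^ 2) / (2 * Real.pi)) =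
      2 / Real.pi * Real.sin θ ^ 2 := by
  have hs := Real.sin_pos_of_pos_of_lt_pi hθ.1 hθ.2
  have h : 4 - (2 * Real.cos θ) ^ 2 = (2 * Real.sin θ) ^ 2 := by
    nlinarith [Real.sin_sq_add_cos_sq θ]
  rw [h, Real.sqrt_sq (by positivity), abs_mul, abs_of_pos hs]
  have := Real.pi_pos
  norm_num
  field_simp

theorem measurable_semicircleDensity :
    Measurable fun t : ℝ => ENNReal.ofReal (√(4 - t ^ 2) / (2 * Real.pi)) := by
  fun_prop

theorem semicircleDensity_eq_zero {t : ℝ} (ht : t ∉ Set.Ioo (-2 : ℝ) 2) :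
    √(4 - t ^ 2) / (2 * Real.pi) = 0 := by
  rw [Real.sqrt_eq_zero_of_nonpos, zero_div]
  by_contra! hc
  exact ht ⟨by nlinarith, by nlinarith⟩

/-- The substitution `t = 2 cos θ` turns the semicircle law into `(2/π) sin² θ dθ` on `(0, π)`. -/
theorem integral_semicircleLaw (f : ℝ → E) :
    ∫ t, f t ∂semicircleLaw =
      ∫ θ in Set.Ioo 0 Real.pi, (2 / Real.pi * Real.sin θ ^ 2) • f (2 * Real.cos θ) := by
  have hpos : ∀ t : ℝ, 0 ≤ √(4 - t ^ 2) / (2 * Real.pi) := fun t => by positivity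
  rw [semicircleLaw, integral_withDensity_eq_integral_toReal_smul measurable_semicircleDensity
    (ae_of_all _ fun t => ENNReal.ofReal_lt_top)]
  simp_rw [ENNReal.toReal_ofReal (hpos _)]
  rw [← setIntegral_eq_integral_of_forall_compl_eq_zero (s := Set.Ioo (-2 : ℝ) 2)
    (fun t ht => by rw [semicircleDensity_eq_zero ht, zero_smul]), ← image_two_mul_cos,
    integral_image_eq_integral_abs_deriv_smul measurableSet_Ioo
      (fun x _ => hasDerivWithinAt_two_mul_cos x) injOn_two_mul_cos]
  refine setIntegral_congr_fun measurableSet_Ioo fun θ hθ => ?_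
  rw [smul_smul, semicircle_jacobian hθ]

theorem integrable_semicircleLaw_iff (f : ℝ → E) :
    Integrable f semicircleLaw ↔ IntegrableOn
      (fun θ => (2 / Real.pi * Real.sin θ ^ 2) • f (2 * Real.cos θ)) (Set.Ioo 0 Real.pi) := by
  have hpos : ∀ t : ℝ, 0 ≤ √(4 - t ^ 2) / (2 * Real.pi) := fun t => by positivity
  rw [semicircleLaw, integrable_withDensity_iff_integrable_smul' measurable_semicircleDensity
    (ae_of_all _ fun t => ENNReal.ofReal_lt_top)]
  simp_rw [ENNReal.toReal_ofReal (hpos _)]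
  rw [← integrableOn_iff_integrable_of_support_subset (s := Set.Ioo (-2 : ℝ) 2)
    (fun t ht => by
      by_contra h
      exact ht (by dsimp only; rw [semicircleDensity_eq_zero h, zero_smul])),
    ← image_two_mul_cos,
    integrableOn_image_iff_integrableOn_abs_deriv_smul measurableSet_Ioo
      (fun x _ => hasDerivWithinAt_two_mul_cos x) injOn_two_mul_cos]
  refine integrableOn_congr_fun (fun θ hθ => ?_) measurableSet_Ioo
  rw [smul_smul, semicircle_jacobian hθ]

theorem ae_semicircleLaw_mem : ∀ᵐ t ∂semicircleLaw, t ∈ Set.Ioo (-2 : ℝ) 2 := by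
  rw [semicircleLaw, ae_withDensity_iff measurable_semicircleDensity]
  refine ae_of_all _ fun t ht => ?_
  by_contra h
  exact ht (by rw [semicircleDensity_eq_zero h, ENNReal.ofReal_zero])

end Semicircle

/-- The rational function `u ↦ 1 / (1 + ζ² - ζ u)`, the generating function `∑ ζᵏ Uₖ(u / 2)` of the
Chebyshev polynomials of the second kind. -/
noncomputable def chebyshevKernel (ζ : ℂ) (u : ℝ) : ℂ := 1 / (1 + ζ ^ 2 - ζ * u)

theorem chebyshevKernel_denom_factor (ζ : ℂ) (θ : ℝ) :
    1 + ζ ^ 2 - ζ * ((2 * Real.cos θ : ℝ) : ℂ) =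
      (1 - ζ * Complex.exp (θ * Complex.I)) * (1 - ζ * Complex.exp (-θ * Complex.I)) := by
  have h : Complex.exp (θ * Complex.I) * Complex.exp (-θ * Complex.I) = 1 := by
    rw [← Complex.exp_add]; simp
  push_cast
  rw [Complex.two_cos]
  linear_combination (-ζ ^ 2) * h

theorem one_sub_mul_exp_ne_zero {ζ : ℂ} (hζ : ‖ζ‖ < 1) (θ : ℝ) :
    1 - ζ * Complex.exp (θ * Complex.I) ≠ 0 := by
  intro h
  have h1 : ‖ζ * Complex.exp (θ * Complex.I)‖ = 1 := by
    rw [← sub_eq_zero.1 h, norm_one]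
  rw [norm_mul, Complex.norm_exp_ofReal_mul_I, mul_one] at h1
  linarith

theorem one_sub_mul_exp_neg_ne_zero {ζ : ℂ} (hζ : ‖ζ‖ < 1) (θ : ℝ) :
    1 - ζ * Complex.exp (-θ * Complex.I) ≠ 0 := by
  simpa using one_sub_mul_exp_ne_zero hζ (-θ)

theorem chebyshevKernel_denom_ne_zero {ζ : ℂ} (hζ : ‖ζ‖ < 1) {u : ℝ} (hu : u ∈ Set.Icc (-2 : ℝ) 2) :
    1 + ζ ^ 2 - ζ * u ≠ 0 := by
  have h : u = 2 * Real.cos (Real.arccos (u / 2)) := by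
    rw [Real.cos_arccos (by linarith [hu.1]) (by linarith [hu.2])]; ring
  rw [h, chebyshevKernel_denom_factor]
  exact mul_ne_zero (one_sub_mul_exp_ne_zero hζ _) (one_sub_mul_exp_neg_ne_zero hζ _)

theorem integrable_semicircleLaw_of_continuousOn {E : Type*} [NormedAddCommGroup E]
    [NormedSpace ℝ E] {f : ℝ → E} (hf : ContinuousOn f (Set.Icc (-2 : ℝ) 2)) :
    Integrable f semicircleLaw := by
  rw [integrable_semicircleLaw_iff]
  refine IntegrableOn.mono_set ?_ Set.Ioo_subset_Icc_self
  refine ContinuousOn.integrableOn_Icc ?_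
  refine ContinuousOn.smul (by fun_prop) (hf.comp (by fun_prop) fun θ _ => ?_)
  constructor <;> linarith [Real.neg_one_le_cos θ, Real.cos_le_one θ]

theorem integrable_chebyshevKernel {ζ : ℂ} (hζ : ‖ζ‖ < 1) :
    Integrable (chebyshevKernel ζ) semicircleLaw := by
  refine integrable_semicircleLaw_of_continuousOn ?_
  unfold chebyshevKernel
  exact ContinuousOn.div (by fun_prop) (by fun_prop) fun u hu => chebyshevKernel_denom_ne_zero hζ hu

/-- `sin² θ / (1 + ζ² - 2 ζ cos θ)` is the even part of a function holomorphic in `exp (i θ)`, so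
its integral is given by the mean value property. -/
theorem integral_sin_sq_mul_kernel {ζ : ℂ} (hζ : ‖ζ‖ < 1) (h0 : ζ ≠ 0) :
    ∫ θ in (0 : ℝ)..Real.pi, ((Real.sin θ : ℂ) ^ 2) * chebyshevKernel ζ (2 * Real.cos θ) =
      Real.pi / 2 := by
  have hne := one_sub_mul_exp_ne_zero hζ
  have hne' := one_sub_mul_exp_neg_ne_zero hζ
  set F : ℂ → ℂ := fun e => (e ^ 2 - 1) / (1 - ζ * e) with hF
  have hmean : Real.circleAverage F 0 1 = -1 := by
    have : DiffContOnCl ℂ F (Metric.ball 0 |1|) := by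
      apply DifferentiableOn.diffContOnCl
      refine DifferentiableOn.div (by fun_prop) (by fun_prop) fun e he => ?_
      rw [abs_one, closure_ball _ one_ne_zero, mem_closedBall_zero_iff] at he
      intro h
      have h1 : ‖ζ * e‖ = 1 := by rw [← sub_eq_zero.1 h, norm_one]
      rw [norm_mul] at h1
      nlinarith [norm_nonneg ζ, norm_nonneg e]
    rw [this.circleAverage]
    simp [hF]
  set h : ℝ → ℂ := fun θ => (Real.sin θ : ℂ) / (1 - ζ * Complex.exp (θ * Complex.I)) with hh
  have hcont : Continuous h := by
    refine Continuous.div (by fun_prop) (by fun_prop) hne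
  have hper : Function.Periodic h (2 * Real.pi) := by
    intro θ
    simp only [hh, Real.sin_add_two_pi]
    push_cast
    rw [add_mul, Complex.exp_add, Complex.exp_two_pi_mul_I, mul_one]
  have hsplit : ∀ θ : ℝ, h θ = (Real.sin θ : ℂ) +
      ζ / (2 * Complex.I) * F (circleMap 0 1 θ) := by
    intro θ
    have hee : Complex.exp (θ * Complex.I) * Complex.exp (-θ * Complex.I) = 1 := by
      rw [← Complex.exp_add]; simp
    have hsin : (Real.sin θ : ℂ) = (Complex.exp (-θ * Complex.I) - Complex.exp (θ * Complex.I)) *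
      Complex.I / 2 := by rw [Complex.ofReal_sin, Complex.sin]
    simp only [hh, hF, circleMap, Complex.ofReal_one, one_mul, zero_add]
    rw [hsin]
    have := hne θ
    have hI : Complex.I ^ 2 = -1 := Complex.I_sq
    generalize Complex.exp (θ * Complex.I) = e at *
    generalize Complex.exp (-θ * Complex.I) = e' at *
    obtain ⟨d, hd⟩ : ∃ d, d = 1 - ζ * e := ⟨_, rfl⟩
    rw [← hd] at this ⊢
    field_simp
    rw [hI, hd]
    linear_combination (-ζ) * hee
  have htot : ∫ θ in (-Real.pi)..Real.pi, h θ = ζ / (2 * Complex.I) * (2 * Real.pi * (-1)) := by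
    have e1 := hper.intervalIntegral_add_eq (-Real.pi) 0
    rw [show -Real.pi + 2 * Real.pi = Real.pi by ring, zero_add] at e1
    rw [e1, intervalIntegral.integral_congr (fun θ _ => hsplit θ), intervalIntegral.integral_add]
    · rw [intervalIntegral.integral_const_mul, ← hmean, Real.circleAverage_def]
      have : ∫ θ in (0 : ℝ)..(2 * Real.pi), (Real.sin θ : ℂ) = 0 := by
        rw [intervalIntegral.integral_ofReal]; simp
      rw [this, zero_add, Complex.real_smul]
      congr 1
      have := Real.pi_ne_zero
      push_cast
      field_simp
    · exact Continuous.intervalIntegrable (by fun_prop) _ _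
    · refine Continuous.intervalIntegrable ?_ _ _
      have : (fun θ => ζ / (2 * Complex.I) * F (circleMap 0 1 θ)) =
          fun θ : ℝ => h θ - Real.sin θ := by
        funext θ; rw [hsplit]; ring
      rw [this]; fun_prop
  have hpt : ∀ θ : ℝ, ((Real.sin θ : ℂ) ^ 2) * chebyshevKernel ζ (2 * Real.cos θ) =
      1 / (2 * Complex.I * ζ) * (h θ + h (-θ)) := by
    intro θ
    have hsin : (Real.sin θ : ℂ) = (Complex.exp (-θ * Complex.I) - Complex.exp (θ * Complex.I)) *
      Complex.I / 2 := by rw [Complex.ofReal_sin, Complex.sin]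
    have hI : Complex.I ^ 2 = -1 := Complex.I_sq
    have h1 := hne θ
    have h2 := hne' θ
    simp only [hh, chebyshevKernel, chebyshevKernel_denom_factor, Real.sin_neg, Complex.ofReal_neg]
    rw [hsin]
    generalize Complex.exp (θ * Complex.I) = e at *
    generalize Complex.exp (-θ * Complex.I) = e' at *
    obtain ⟨d, hd⟩ : ∃ d, d = 1 - ζ * e := ⟨_, rfl⟩
    obtain ⟨d', hd'⟩ : ∃ d', d' = 1 - ζ * e' := ⟨_, rfl⟩
    rw [← hd] at h1 ⊢
    rw [← hd'] at h2 ⊢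
    field_simp
    rw [hI, hd, hd']
    ring
  rw [intervalIntegral.integral_congr (fun θ _ => hpt θ), intervalIntegral.integral_const_mul,
    intervalIntegral.integral_add (hcont.intervalIntegrable _ _)
      (Continuous.intervalIntegrable (by fun_prop) _ _),
    intervalIntegral.integral_comp_neg (fun θ => h θ), neg_zero, add_comm,
    intervalIntegral.integral_add_adjacent_intervals (hcont.intervalIntegrable _ _)
      (hcont.intervalIntegrable _ _), htot]
  field_simp
  rw [Complex.I_sq]

theorem integral_chebyshevKernel {ζ : ℂ} (hζ : ‖ζ‖ < 1) :
    ∫ u, chebyshevKernel ζ u ∂semicircleLaw = 1 := by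
  rcases eq_or_ne ζ 0 with rfl | h0
  · simp [chebyshevKernel]
  rw [integral_semicircleLaw, ← integral_Ioc_eq_integral_Ioo,
    ← intervalIntegral.integral_of_le Real.pi_pos.le]
  have : ∀ θ : ℝ, (2 / Real.pi * Real.sin θ ^ 2) • chebyshevKernel ζ (2 * Real.cos θ) =
      (2 / Real.pi : ℂ) * ((Real.sin θ : ℂ) ^ 2 * chebyshevKernel ζ (2 * Real.cos θ)) := by
    intro θ
    rw [Complex.real_smul]
    push_cast
    ring
  simp_rw [this]
  rw [intervalIntegral.integral_const_mul, integral_sin_sq_mul_kernel hζ h0]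
  have : (Real.pi : ℂ) ≠ 0 := by exact_mod_cast Real.pi_ne_zero
  field_simp

/-- At the two boundary points `ζ = ±1` the integrand is `(1 ± cos θ) / 2`: the singularity of the
kernel at the edge of the spectrum is cancelled by the density. -/
theorem chebyshevKernel_edge {ζ : ℝ} (hζ : ζ ^ 2 = 1) {θ : ℝ} (hθ : θ ∈ Set.Ioo 0 Real.pi) :
    (2 / Real.pi * Real.sin θ ^ 2) • chebyshevKernel ζ (2 * Real.cos θ) =
      ((1 / Real.pi * (1 + ζ * Real.cos θ) : ℝ) : ℂ) := by
  have hs := Real.sin_pos_of_pos_of_lt_pi hθ.1 hθ.2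
  have hfac : Real.sin θ ^ 2 = (1 + ζ * Real.cos θ) * (1 - ζ * Real.cos θ) := by
    linear_combination Real.sin_sq_add_cos_sq θ + Real.cos θ ^ 2 * hζ
  have hne : 1 - ζ * Real.cos θ ≠ 0 := by
    intro h
    rw [h, mul_zero] at hfac
    exact hs.ne' (pow_eq_zero_iff two_ne_zero |>.1 hfac)
  rw [chebyshevKernel, Complex.real_smul]
  have hpi := Real.pi_ne_zero
  norm_cast
  rw [hfac, hζ]
  rw [show 1 + 1 - ζ * (2 * Real.cos θ) = 2 * (1 - ζ * Real.cos θ) by ring]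
  field_simp

theorem integrable_chebyshevKernel_real {β : ℝ} (hβ : |β| ≤ 1) :
    Integrable (chebyshevKernel β) semicircleLaw := by
  rcases hβ.lt_or_eq with h | h
  · exact integrable_chebyshevKernel (by simpa using h)
  · have h2 : β ^ 2 = 1 := by rw [← sq_abs, h, one_pow]
    rw [integrable_semicircleLaw_iff,
      integrableOn_congr_fun (fun θ hθ => chebyshevKernel_edge h2 hθ) measurableSet_Ioo]
    refine IntegrableOn.mono_set ?_ Set.Ioo_subset_Icc_self
    exact ContinuousOn.integrableOn_Icc (by fun_prop)

theorem integral_chebyshevKernel_real {β : ℝ} (hβ : |β| ≤ 1) :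
    ∫ u, chebyshevKernel β u ∂semicircleLaw = 1 := by
  rcases hβ.lt_or_eq with h | h
  · exact integral_chebyshevKernel (by simpa using h)
  · have h2 : β ^ 2 = 1 := by rw [← sq_abs, h, one_pow]
    rw [integral_semicircleLaw,
      setIntegral_congr_fun measurableSet_Ioo fun θ hθ => chebyshevKernel_edge h2 hθ,
      integral_complex_ofReal, ← integral_Ioc_eq_integral_Ioo,
      ← intervalIntegral.integral_of_le Real.pi_pos.le, intervalIntegral.integral_const_mul,
      intervalIntegral.integral_add (by simp)
        (Continuous.intervalIntegrable (by fun_prop) _ _), intervalIntegral.integral_const_mul]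
    simp

/-! ### Spiked semicircle laws -/

theorem kernelDenom_pos (β : ℝ) {u : ℝ} (hu : u ∈ Set.Ioo (-2 : ℝ) 2) : 0 < 1 + β ^ 2 - β * u := by
  nlinarith [sq_nonneg (β - u / 2), hu.1, hu.2, mul_pos (sub_pos.2 hu.1) (sub_pos.2 hu.2)]

theorem chebyshevKernel_ofReal (β u : ℝ) :
    chebyshevKernel β u = ((1 / (1 + β ^ 2 - β * u) : ℝ) : ℂ) := by
  simp [chebyshevKernel]

/-- The weight of the atom of `spikedSemicircle β`: `1 - β⁻²` if `|β| > 1`, and `0` otherwise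
(for `β = 0` thanks to the convention `x / 0 = 0`). -/
noncomputable def spikeMass (β : ℝ) : ℝ := max ((β ^ 2 - 1) / β ^ 2) 0

theorem spikeMass_nonneg (β : ℝ) : 0 ≤ spikeMass β := le_max_right _ _

theorem spikeMass_of_abs_le {β : ℝ} (h : |β| ≤ 1) : spikeMass β = 0 := by
  have : β ^ 2 ≤ 1 := (sq_le_one_iff_abs_le_one β).2 h
  exact max_eq_right (div_nonpos_of_nonpos_of_nonneg (by linarith) (sq_nonneg β))

theorem spikeMass_of_lt_abs {β : ℝ} (h : 1 < |β|) : spikeMass β = 1 - 1 / β ^ 2 := by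
  have h2 : 1 < β ^ 2 := (one_lt_sq_iff_one_lt_abs β).2 h
  rw [spikeMass, max_eq_left (div_nonneg (by linarith) (sq_nonneg β)), sub_div,
    div_self (by linarith)]

/-- The symmetry `β ↔ 1 / β` reduces the case `|β| > 1` to `|β| < 1`. -/
theorem chebyshevKernel_inv {β : ℝ} (h : β ≠ 0) (u : ℝ) :
    chebyshevKernel β u = (1 / β ^ 2 : ℂ) * chebyshevKernel ((β⁻¹ : ℝ) : ℂ) u := by
  have hb : (β : ℂ) ≠ 0 := by exact_mod_cast h
  have h1 : (1 + (β : ℂ) ^ 2 - β * u) =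
      β ^ 2 * (1 + (((β⁻¹ : ℝ) : ℂ)) ^ 2 - ((β⁻¹ : ℝ) : ℂ) * u) := by
    push_cast
    field_simp
    ring
  rw [chebyshevKernel, chebyshevKernel, h1, one_div_mul_one_div]

theorem integrable_chebyshevKernel_ofReal (β : ℝ) :
    Integrable (chebyshevKernel β) semicircleLaw := by
  rcases le_or_gt |β| 1 with h | h
  · exact integrable_chebyshevKernel_real h
  · have h0 : β ≠ 0 := by rintro rfl; norm_num at h
    have h1 : |β⁻¹| ≤ 1 := by rw [abs_inv]; exact inv_le_one_of_one_le₀ h.le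
    simp_rw [funext (chebyshevKernel_inv h0)]
    exact (integrable_chebyshevKernel_real h1).const_mul _

theorem integral_chebyshevKernel_ofReal (β : ℝ) :
    ∫ u, chebyshevKernel β u ∂semicircleLaw = 1 - spikeMass β := by
  rcases le_or_gt |β| 1 with h | h
  · rw [integral_chebyshevKernel_real h, spikeMass_of_abs_le h]; simp
  · have h0 : β ≠ 0 := by rintro rfl; norm_num at h
    have h1 : |β⁻¹| ≤ 1 := by rw [abs_inv]; exact inv_le_one_of_one_le₀ h.le
    simp_rw [chebyshevKernel_inv h0]
    rw [integral_const_mul, integral_chebyshevKernel_real h1, spikeMass_of_lt_abs h]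
    simp

theorem integrable_kernel (β : ℝ) :
    Integrable (fun u : ℝ => 1 / (1 + β ^ 2 - β * u)) semicircleLaw := by
  have h := integrable_chebyshevKernel_ofReal β
  rw [funext (chebyshevKernel_ofReal β)] at h
  exact h.re

theorem integral_kernel (β : ℝ) :
    ∫ u : ℝ, 1 / (1 + β ^ 2 - β * u) ∂semicircleLaw = 1 - spikeMass β := by
  have h := integral_chebyshevKernel_ofReal β
  simp_rw [chebyshevKernel_ofReal] at h
  rw [integral_complex_ofReal] at h
  exact_mod_cast h

/-- The semicircle law reweighted by `1 / (1 + β² - β u)`, with an atom at `β + 1 / β` for the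
missing mass when `|β| > 1`. It is the probability measure with Cauchy transform `ζ / (1 - β ζ)` at
`ζ + 1 / ζ` for small `ζ`. -/
noncomputable def spikedSemicircle (β : ℝ) : Measure ℝ :=
  semicircleLaw.withDensity (fun u => ENNReal.ofReal (1 / (1 + β ^ 2 - β * u))) +
    ENNReal.ofReal (spikeMass β) • Measure.dirac (β + 1 / β)

theorem spikeMass_le_one (β : ℝ) : spikeMass β ≤ 1 := by
  rcases le_or_gt |β| 1 with h | h
  · simp [spikeMass_of_abs_le h]
  · rw [spikeMass_of_lt_abs h]
    have : 0 ≤ 1 / β ^ 2 := by positivity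
    linarith

theorem kernel_nonneg_ae (β : ℝ) : ∀ᵐ u ∂semicircleLaw, 0 ≤ 1 / (1 + β ^ 2 - β * u) :=
  ae_semicircleLaw_mem.mono fun _ hu => (one_div_pos.2 (kernelDenom_pos β hu)).le

theorem measurable_kernel (β : ℝ) :
    Measurable fun u : ℝ => ENNReal.ofReal (1 / (1 + β ^ 2 - β * u)) := by
  fun_prop

instance isProbabilityMeasure_spikedSemicircle (β : ℝ) :
    IsProbabilityMeasure (spikedSemicircle β) := by
  refine ⟨?_⟩
  rw [spikedSemicircle, Measure.add_apply, withDensity_apply _ MeasurableSet.univ,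
    Measure.restrict_univ, ← ofReal_integral_eq_lintegral_ofReal (integrable_kernel β)
      (kernel_nonneg_ae β), integral_kernel]
  simp only [Measure.smul_apply, measure_univ, smul_eq_mul, mul_one]
  rw [← ENNReal.ofReal_add (by linarith [spikeMass_le_one β]) (spikeMass_nonneg β)]
  simp

theorem ae_spikedSemicircle_mem (β : ℝ) :
    ∀ᵐ u ∂spikedSemicircle β, u ∈ Set.Icc (-2 : ℝ) 2 ∪ {β + 1 / β} := by
  rw [spikedSemicircle, ae_add_measure_iff]
  constructor
  · refine (withDensity_absolutelyContinuous _ _).ae_le ?_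
    exact ae_semicircleLaw_mem.mono fun u hu => Or.inl (Set.Ioo_subset_Icc_self hu)
  · refine Measure.ae_smul_measure ?_ _
    rw [ae_dirac_eq]
    exact Or.inr rfl

theorem ae_spikedSemicircle_mem_of_abs_le {β : ℝ} (h : |β| ≤ 1) :
    ∀ᵐ u ∂spikedSemicircle β, u ∈ Set.Icc (-2 : ℝ) 2 := by
  rw [spikedSemicircle, spikeMass_of_abs_le h, ENNReal.ofReal_zero, zero_smul, add_zero]
  refine (withDensity_absolutelyContinuous _ _).ae_le ?_
  exact ae_semicircleLaw_mem.mono fun u hu => Set.Ioo_subset_Icc_self hu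

theorem weighted_ae_eq (β : ℝ) (f : ℝ → ℂ) :
    (fun u => (ENNReal.ofReal (1 / (1 + β ^ 2 - β * u))).toReal • f u) =ᵐ[semicircleLaw]
      fun u => chebyshevKernel β u * f u := by
  filter_upwards [kernel_nonneg_ae β] with u hu
  rw [ENNReal.toReal_ofReal hu, chebyshevKernel_ofReal, Complex.real_smul]

theorem integrable_weighted (β : ℝ) {f : ℝ → ℂ}
    (hf : Integrable (fun u => chebyshevKernel β u * f u) semicircleLaw) :
    Integrable f
      (semicircleLaw.withDensity fun u => ENNReal.ofReal (1 / (1 + β ^ 2 - β * u))) := by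
  rw [integrable_withDensity_iff_integrable_smul' (measurable_kernel β)
    (ae_of_all _ fun _ => ENNReal.ofReal_lt_top)]
  exact hf.congr (weighted_ae_eq β f).symm

theorem integrable_smul_dirac (c x : ℝ) (f : ℝ → ℂ) :
    Integrable f (ENNReal.ofReal c • Measure.dirac x) :=
  (integrable_dirac (by simp)).smul_measure ENNReal.ofReal_ne_top

theorem integrable_spikedSemicircle (β : ℝ) {f : ℝ → ℂ}
    (hf : Integrable (fun u => chebyshevKernel β u * f u) semicircleLaw) :
    Integrable f (spikedSemicircle β) :=
  (integrable_weighted β hf).add_measure (integrable_smul_dirac _ _ _)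

theorem integral_spikedSemicircle (β : ℝ) {f : ℝ → ℂ}
    (hf : Integrable (fun u => chebyshevKernel β u * f u) semicircleLaw) :
    ∫ u, f u ∂spikedSemicircle β =
      ∫ u, chebyshevKernel β u * f u ∂semicircleLaw + spikeMass β * f (β + 1 / β) := by
  rw [spikedSemicircle, integral_add_measure (integrable_weighted β hf)
      (integrable_smul_dirac _ _ _), integral_smul_measure, integral_dirac,
    integral_withDensity_eq_integral_toReal_smul (measurable_kernel β)
      (ae_of_all _ fun _ => ENNReal.ofReal_lt_top), integral_congr_ae (weighted_ae_eq β f),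
    ENNReal.toReal_ofReal (spikeMass_nonneg β), Complex.real_smul]

theorem one_div_sub_eq_kernel {ζ : ℂ} (h0 : ζ ≠ 0) (u : ℝ) :
    1 / (ζ + 1 / ζ - u) = ζ * chebyshevKernel ζ u := by
  have : ζ + 1 / ζ - u = (1 + ζ ^ 2 - ζ * u) / ζ := by field_simp; ring
  rw [this, chebyshevKernel, one_div_div]
  ring

theorem cauchyTransform_semicircleLaw {ζ : ℂ} (h0 : ζ ≠ 0) (h1 : ‖ζ‖ < 1) :
    cauchyTransform semicircleLaw (ζ + 1 / ζ) = ζ := by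
  simp_rw [cauchyTransform, one_div_sub_eq_kernel h0]
  rw [integral_const_mul, integral_chebyshevKernel h1, mul_one]

/-- Partial fractions for the product of two kernels. -/
theorem chebyshevKernel_mul_ae {β : ℝ} {ζ : ℂ} (h1 : ‖ζ‖ < 1) (h2 : (β : ℂ) - ζ ≠ 0)
    (h3 : 1 - β * ζ ≠ 0) : (fun u => chebyshevKernel β u * chebyshevKernel ζ u) =ᵐ[semicircleLaw]
      fun u => 1 / ((β - ζ) * (1 - β * ζ)) *
        (β * chebyshevKernel β u - ζ * chebyshevKernel ζ u) := by
  filter_upwards [ae_semicircleLaw_mem] with u hu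
  have e1 : (1 + (β : ℂ) ^ 2 - β * u) ≠ 0 := by exact_mod_cast (kernelDenom_pos β hu).ne'
  have e2 := chebyshevKernel_denom_ne_zero h1 (Set.Ioo_subset_Icc_self hu)
  have key : ((β : ℂ) - ζ) * (1 - β * ζ) =
      β * (1 + ζ ^ 2 - ζ * u) - ζ * (1 + (β : ℂ) ^ 2 - β * u) := by ring
  have h4 := mul_ne_zero h2 h3
  rw [key] at h4 ⊢
  simp only [chebyshevKernel]
  generalize 1 + (β : ℂ) ^ 2 - β * u = d at *
  generalize 1 + ζ ^ 2 - ζ * u = d' at *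
  obtain ⟨D, hD⟩ : ∃ D, D = β * d' - ζ * d := ⟨_, rfl⟩
  rw [← hD] at h4 ⊢
  field_simp
  rw [hD]
  ring

theorem integrable_chebyshevKernel_mul {β : ℝ} {ζ : ℂ} (h1 : ‖ζ‖ < 1) (h2 : (β : ℂ) - ζ ≠ 0)
    (h3 : 1 - β * ζ ≠ 0) :
    Integrable (fun u => chebyshevKernel β u * chebyshevKernel ζ u) semicircleLaw :=
  Integrable.congr ((((integrable_chebyshevKernel_ofReal β).const_mul _).sub
    ((integrable_chebyshevKernel h1).const_mul _)).const_mul _)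
    (chebyshevKernel_mul_ae h1 h2 h3).symm

theorem integral_chebyshevKernel_mul {β : ℝ} {ζ : ℂ} (h1 : ‖ζ‖ < 1) (h2 : (β : ℂ) - ζ ≠ 0)
    (h3 : 1 - β * ζ ≠ 0) :
    ∫ u, chebyshevKernel β u * chebyshevKernel ζ u ∂semicircleLaw =
      1 / ((β - ζ) * (1 - β * ζ)) * (β * (1 - spikeMass β) - ζ) := by
  rw [integral_congr_ae (chebyshevKernel_mul_ae h1 h2 h3), integral_const_mul,
    integral_sub ((integrable_chebyshevKernel_ofReal β).const_mul _)
      ((integrable_chebyshevKernel h1).const_mul _), integral_const_mul, integral_const_mul,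
    integral_chebyshevKernel_ofReal, integral_chebyshevKernel h1, mul_one]

theorem integrable_one_div_sub_spikedSemicircle {β : ℝ} {ζ : ℂ} (h0 : ζ ≠ 0) (h1 : ‖ζ‖ < 1)
    (h2 : (β : ℂ) - ζ ≠ 0) (h3 : 1 - β * ζ ≠ 0) :
    Integrable (fun u : ℝ => 1 / (ζ + 1 / ζ - u)) (spikedSemicircle β) := by
  simp_rw [one_div_sub_eq_kernel h0]
  exact (integrable_spikedSemicircle β (integrable_chebyshevKernel_mul h1 h2 h3)).const_mul _

theorem cauchyTransform_spikedSemicircle {β : ℝ} {ζ : ℂ} (h0 : ζ ≠ 0) (h1 : ‖ζ‖ < 1)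
    (h2 : (β : ℂ) - ζ ≠ 0) (h3 : 1 - β * ζ ≠ 0) :
    cauchyTransform (spikedSemicircle β) (ζ + 1 / ζ) = ζ / (1 - β * ζ) := by
  simp_rw [cauchyTransform, one_div_sub_eq_kernel h0]
  rw [integral_const_mul, integral_spikedSemicircle β (integrable_chebyshevKernel_mul h1 h2 h3),
    integral_chebyshevKernel_mul h1 h2 h3]
  -- the atom contributes exactly the missing multiple of `β` to the partial fractions
  have key : (spikeMass β : ℂ) * chebyshevKernel ζ (β + 1 / β) =
      1 / ((β - ζ) * (1 - β * ζ)) * (β * spikeMass β) := by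
    rcases eq_or_ne β 0 with rfl | hb
    · simp [spikeMass]
    · have hb' : (β : ℂ) ≠ 0 := by exact_mod_cast hb
      have : 1 + ζ ^ 2 - ζ * ((β + 1 / β : ℝ) : ℂ) = (β - ζ) * (1 - β * ζ) / β := by
        push_cast
        field_simp
        ring
      rw [chebyshevKernel, this, one_div_div]
      ring
  rw [key, ← mul_add, show (β : ℂ) * (1 - spikeMass β) - ζ + β * spikeMass β = β - ζ by ring,
    one_div_mul_eq_div, div_mul_cancel_left₀ h2, div_eq_mul_inv]

/-! ### Compactly supported measures, Cauchy transforms and `K`-functions -/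

theorem IsCompactProbability.exists_bound {μ : Measure ℝ} (h : IsCompactProbability μ) :
    ∃ R : ℝ, 0 < R ∧ ∀ᵐ t ∂μ, |t| ≤ R := by
  obtain ⟨R, hR0, hR⟩ := h.2.isBounded.exists_pos_norm_le
  exact ⟨R, hR0, Filter.mem_of_superset Measure.support_mem_ae fun t ht => by simpa using hR t ht⟩

theorem isCompactProbability_of_ae_mem {μ : Measure ℝ} [IsProbabilityMeasure μ] {s : Set ℝ}
    (hs : IsCompact s) (h : ∀ᵐ t ∂μ, t ∈ s) : IsCompactProbability μ :=
  ⟨inferInstance, hs.of_isClosed_subset Measure.isClosed_support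
    (Measure.support_subset_of_isClosed hs.isClosed h)⟩

section Moments

variable {μ ν : Measure ℝ} {R : ℝ}

theorem abs_pow_div_le {R t u : ℝ} (hR : 0 < R) (ht : |t| ≤ R) (hu : |u| ≤ 1 / (2 * R)) (k : ℕ) :
    1 / 2 ≤ 1 - u * t ∧ |t ^ k / (1 - u * t)| ≤ 2 * R ^ k := by
  have h1 : |u * t| ≤ 1 / 2 := by
    rw [abs_mul]
    calc |u| * |t| ≤ 1 / (2 * R) * R := by gcongr
      _ = 1 / 2 := by field_simp
  have h2 : 1 / 2 ≤ 1 - u * t := by linarith [(abs_le.1 h1).2]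
  refine ⟨h2, ?_⟩
  rw [abs_div, abs_of_pos (by linarith : 0 < 1 - u * t), div_le_iff₀ (by linarith), abs_pow]
  have : |t| ^ k ≤ R ^ k := by gcongr
  nlinarith [pow_pos hR k]

theorem integrable_pow_div [IsProbabilityMeasure μ] (hR : 0 < R) (hμ : ∀ᵐ t ∂μ, |t| ≤ R) {u : ℝ}
    (hu : |u| ≤ 1 / (2 * R)) (k : ℕ) : Integrable (fun t => t ^ k / (1 - u * t)) μ := by
  refine Integrable.of_bound (Measurable.aestronglyMeasurable (by fun_prop)) (2 * R ^ k) ?_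
  filter_upwards [hμ] with t ht using (abs_pow_div_le hR ht hu k).2

theorem eventually_abs_le_nhdsNE {c : ℝ} (hc : 0 < c) : ∀ᶠ u in 𝓝[≠] (0 : ℝ), |u| ≤ c := by
  refine nhdsWithin_le_nhds ?_
  filter_upwards [Metric.closedBall_mem_nhds (0 : ℝ) hc] with u hu
  simpa using hu

theorem tendsto_integral_pow_div [IsProbabilityMeasure μ] (hR : 0 < R) (hμ : ∀ᵐ t ∂μ, |t| ≤ R)
    (k : ℕ) : Tendsto (fun u : ℝ => ∫ t, t ^ k / (1 - u * t) ∂μ) (𝓝[≠] 0) (𝓝 (∫ t, t ^ k ∂μ)) := by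
  refine tendsto_integral_filter_of_dominated_convergence (fun _ => 2 * R ^ k)
    (Eventually.of_forall fun u => Measurable.aestronglyMeasurable (by fun_prop)) ?_
    (integrable_const _) ?_
  · filter_upwards [eventually_abs_le_nhdsNE (by positivity : 0 < 1 / (2 * R))] with u hu
    filter_upwards [hμ] with t ht using (abs_pow_div_le hR ht hu k).2
  · refine ae_of_all _ fun t => ?_
    refine (tendsto_nhdsWithin_of_tendsto_nhds ?_)
    have : ContinuousAt (fun u : ℝ => t ^ k / (1 - u * t)) 0 := by
      refine ContinuousAt.div (by fun_prop) (by fun_prop) (by simp)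
    simpa [ContinuousAt] using this

theorem integral_pow_div_succ [IsProbabilityMeasure μ] (hR : 0 < R) (hμ : ∀ᵐ t ∂μ, |t| ≤ R) {u : ℝ}
    (hu : |u| ≤ 1 / (2 * R)) (k : ℕ) :
    ∫ t, t ^ k / (1 - u * t) ∂μ = ∫ t, t ^ k ∂μ + u * ∫ t, t ^ (k + 1) / (1 - u * t) ∂μ := by
  have hint : Integrable (fun t : ℝ => t ^ k) μ := by
    simpa using integrable_pow_div hR hμ (u := 0) (by rw [abs_zero]; positivity) k
  rw [← integral_const_mul, ← integral_add hint ((integrable_pow_div hR hμ hu _).const_mul u)]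
  refine integral_congr_ae ?_
  filter_upwards [hμ] with t ht
  have := (abs_pow_div_le hR ht hu k).1
  have : 1 - u * t ≠ 0 := by linarith
  field_simp
  ring

theorem cauchyTransform_ofReal (μ : Measure ℝ) (x : ℝ) :
    cauchyTransform μ x = ((∫ t, 1 / (x - t) ∂μ : ℝ) : ℂ) := by
  rw [cauchyTransform, ← integral_complex_ofReal]
  push_cast
  rfl

/-- The expansion `∫ tᵏ / (1 - u t) = mₖ + u ∫ tᵏ⁺¹ / (1 - u t)` recovers the moments one by one
from the Cauchy transform at `1 / u`, as `u → 0`. -/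
theorem integral_pow_eq_of_cauchyTransform_eq [IsProbabilityMeasure μ] [IsProbabilityMeasure ν]
    (hR : 0 < R) (hμ : ∀ᵐ t ∂μ, |t| ≤ R) (hν : ∀ᵐ t ∂ν, |t| ≤ R)
    (h : ∀ᶠ z in Bornology.cobounded ℂ, cauchyTransform μ z = cauchyTransform ν z) (k : ℕ) :
    ∫ t, t ^ k ∂μ = ∫ t, t ^ k ∂ν := by
  have hsmall := eventually_abs_le_nhdsNE (by positivity : 0 < 1 / (2 * R))
  have hlim : ∀ k : ℕ, (∀ᶠ u in 𝓝[≠] (0 : ℝ),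
      ∫ t, t ^ k / (1 - u * t) ∂μ = ∫ t, t ^ k / (1 - u * t) ∂ν) →
      ∫ t, t ^ k ∂μ = ∫ t, t ^ k ∂ν := fun k hk =>
    tendsto_nhds_unique ((tendsto_integral_pow_div hR hμ k).congr' hk)
      (tendsto_integral_pow_div hR hν k)
  refine hlim k ?_
  induction k with
  | zero =>
    have hinv : Tendsto (fun u : ℝ => ((u⁻¹ : ℝ) : ℂ)) (𝓝[≠] 0) (Bornology.cobounded ℂ) := by
      rw [← tendsto_norm_atTop_iff_cobounded]
      simpa using tendsto_norm_atTop_iff_cobounded.2 (tendsto_inv₀_nhdsNE_zero (α := ℝ))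
    filter_upwards [hinv.eventually h, self_mem_nhdsWithin] with u hu hu0
    rw [cauchyTransform_ofReal, cauchyTransform_ofReal, Complex.ofReal_inj] at hu
    have hu0' : u ≠ 0 := hu0
    have key : ∀ t : ℝ, t ^ 0 / (1 - u * t) = u⁻¹ * (1 / (u⁻¹ - t)) := fun t => by
      rw [show u⁻¹ - t = (1 - u * t) / u by field_simp, one_div_div, ← mul_div_assoc,
        inv_mul_cancel₀ hu0', pow_zero]
    simp_rw [key]
    rw [integral_const_mul, integral_const_mul, hu]
  | succ k ih =>
    filter_upwards [ih, hsmall, self_mem_nhdsWithin] with u hu hus hu0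
    rw [integral_pow_div_succ hR hμ hus, integral_pow_div_succ hR hν hus, hlim k ih,
      add_right_inj] at hu
    exact mul_left_cancel₀ hu0 hu

theorem integrable_of_continuous [IsProbabilityMeasure μ] (hμ : ∀ᵐ t ∂μ, |t| ≤ R) {f : ℝ → ℝ}
    (hf : Continuous f) : Integrable f μ := by
  obtain ⟨C, hC⟩ := (isCompact_Icc (a := -R) (b := R)).exists_bound_of_continuousOn hf.continuousOn
  refine Integrable.of_bound hf.aestronglyMeasurable C ?_
  filter_upwards [hμ] with t ht using hC t (abs_le.1 ht)

/-- By the Weierstrass approximation theorem, moments determine a boundedly supported measure. -/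
theorem eq_of_integral_pow_eq [IsProbabilityMeasure μ] [IsProbabilityMeasure ν]
    (hμ : ∀ᵐ t ∂μ, |t| ≤ R) (hν : ∀ᵐ t ∂ν, |t| ≤ R)
    (h : ∀ k : ℕ, ∫ t, t ^ k ∂μ = ∫ t, t ^ k ∂ν) : μ = ν := by
  refine ext_of_forall_integral_eq_of_IsFiniteMeasure fun f => ?_
  have hpoly : ∀ P : Polynomial ℝ, ∫ t, P.eval t ∂μ = ∫ t, P.eval t ∂ν := by
    intro P
    simp_rw [Polynomial.eval_eq_sum_range]
    rw [integral_finsetSum _ fun i _ => integrable_of_continuous hμ (by fun_prop),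
      integral_finsetSum _ fun i _ => integrable_of_continuous hν (by fun_prop)]
    simp_rw [integral_const_mul, h]
  refine eq_of_forall_dist_le fun ε hε => ?_
  obtain ⟨P, hP⟩ := exists_polynomial_near_of_continuousOn (-R) R f f.continuous.continuousOn
    (ε / 2) (half_pos hε)
  have hclose : ∀ κ : Measure ℝ, IsProbabilityMeasure κ → (∀ᵐ t ∂κ, |t| ≤ R) →
      |∫ t, P.eval t ∂κ - ∫ t, f t ∂κ| ≤ ε / 2 := by
    intro κ _ hκ
    rw [← integral_sub (integrable_of_continuous hκ (by fun_prop))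
      (integrable_of_continuous hκ f.continuous)]
    have := norm_integral_le_of_norm_le_const (μ := κ) (C := ε / 2)
      (f := fun t => P.eval t - f t) (by
        filter_upwards [hκ] with t ht using (hP t (abs_le.1 ht)).le)
    simpa using this
  have h1 := abs_le.1 (hclose μ inferInstance hμ)
  have h2 := abs_le.1 (hclose ν inferInstance hν)
  rw [hpoly] at h1
  rw [Real.dist_eq, abs_le]
  constructor <;> linarith [h1.1, h1.2, h2.1, h2.2]

end Moments

/-- A compactly supported probability measure is determined by its Cauchy transform near `∞`. -/
theorem eq_of_cauchyTransform_eventuallyEq {μ ν : Measure ℝ} (hμ : IsCompactProbability μ)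
    (hν : IsCompactProbability ν)
    (h : ∀ᶠ z in Bornology.cobounded ℂ, cauchyTransform μ z = cauchyTransform ν z) : μ = ν := by
  obtain ⟨R, hR, hμR⟩ := hμ.exists_bound
  obtain ⟨R', hR', hνR⟩ := hν.exists_bound
  have := hμ.1
  have := hν.1
  have h1 : ∀ᵐ t ∂μ, |t| ≤ max R R' := hμR.mono fun t ht => ht.trans (le_max_left _ _)
  have h2 : ∀ᵐ t ∂ν, |t| ≤ max R R' := hνR.mono fun t ht => ht.trans (le_max_right _ _)
  exact eq_of_integral_pow_eq h1 h2
    (integral_pow_eq_of_cauchyTransform_eq (lt_max_of_lt_left hR) h1 h2 h)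

/-- A `K`-function that tends to `∞` at `0` agrees near `0` with every other one. -/
theorem IsKFunction.eventuallyEq {μ : Measure ℝ} {K K' : ℂ → ℂ} (h : IsKFunction μ K)
    (hK : Tendsto K (𝓝[≠] 0) (Bornology.cobounded ℂ)) (h' : IsKFunction μ K') :
    K' =ᶠ[𝓝[≠] 0] K := by
  filter_upwards [hK.eventually h'.1, h.2] with w hw hw'
  rwa [hw'] at hw

theorem IsKFunction.tendsto_cauchyTransform {μ : Measure ℝ} {K : ℂ → ℂ}
    (hμ : IsCompactProbability μ) (h : IsKFunction μ K) :
    Tendsto (cauchyTransform μ) (Bornology.cobounded ℂ) (𝓝[≠] 0) := by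
  obtain ⟨R, hR, hμR⟩ := hμ.exists_bound
  have := hμ.1
  refine tendsto_nhdsWithin_iff.2 ⟨?_, ?_⟩
  · have hn : Tendsto (fun z : ℂ => ‖z‖) (Bornology.cobounded ℂ) atTop :=
      tendsto_norm_cobounded_atTop
    refine squeeze_zero_norm' (a := fun z : ℂ => (‖z‖ - R)⁻¹) ?_
      (tendsto_inv_atTop_zero.comp (tendsto_atTop_add_const_right _ (-R) hn))
    filter_upwards [hn.eventually_gt_atTop R] with z hz
    have := norm_integral_le_of_norm_le_const (μ := μ) (C := (‖z‖ - R)⁻¹)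
      (f := fun t : ℝ => 1 / (z - (t : ℂ))) (by
        filter_upwards [hμR] with t ht
        rw [norm_div, norm_one, one_div]
        refine inv_anti₀ (by linarith) ?_
        have h2 := norm_sub_norm_le z (t : ℂ)
        rw [Complex.norm_real, Real.norm_eq_abs] at h2
        linarith)
    simpa [cauchyTransform] using this
  · -- `K` inverts `G` near infinity, so `G` vanishes there at most at `K 0`
    have : ∀ᶠ z in Bornology.cobounded ℂ, z ≠ K 0 := by
      filter_upwards [tendsto_norm_cobounded_atTop.eventually_gt_atTop ‖K 0‖] with z hz h
      exact hz.ne (by rw [h])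
    filter_upwards [h.1, this] with z hz hz' h0
    exact hz' (by rw [← hz, h0])

/-- The `K`-function near `0` determines a compactly supported probability measure. -/
theorem eq_of_isKFunction_eventuallyEq {μ ν : Measure ℝ} {K K' : ℂ → ℂ}
    (hμ : IsCompactProbability μ) (hν : IsCompactProbability ν) (h : IsKFunction μ K)
    (h' : IsKFunction ν K') (hK : K =ᶠ[𝓝[≠] 0] K') : μ = ν := by
  refine eq_of_cauchyTransform_eventuallyEq hμ hν ?_
  have ht := h'.tendsto_cauchyTransform hν
  filter_upwards [h'.1, ht.eventually hK, ht.eventually h.2] with z h1 h2 h3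
  rw [h2, h1] at h3
  exact h3

/-! ### The parametrization of the free powers -/

/-- A function with nonzero strict derivative and a zero at `0` has a two-sided inverse on punctured
neighborhoods of `0`. -/
theorem exists_inverse_nhdsNE {f : ℂ → ℂ} {c : ℂ} (hf : HasStrictDerivAt f c 0) (hc : c ≠ 0)
    (h0 : f 0 = 0) : ∃ R : ℂ → ℂ, Tendsto R (𝓝[≠] 0) (𝓝[≠] 0) ∧
      (∀ᶠ w in 𝓝[≠] 0, f (R w) = w) ∧ ∀ᶠ ρ in 𝓝[≠] 0, R (f ρ) = ρ := by
  have hr : ∀ᶠ w in 𝓝 (0 : ℂ), f (hf.localInverse f c 0 hc w) = w := by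
    simpa [h0] using hf.eventually_right_inverse hc
  have hl := hf.eventually_left_inverse hc
  have hR0 : hf.localInverse f c 0 hc 0 = 0 := by simpa [h0] using hl.self_of_nhds
  refine ⟨hf.localInverse f c 0 hc, ?_, hr.filter_mono nhdsWithin_le_nhds,
    hl.filter_mono nhdsWithin_le_nhds⟩
  refine tendsto_nhdsWithin_iff.2 ⟨?_, ?_⟩
  · have h := (hf.to_localInverse hc).hasDerivAt.continuousAt
    rw [ContinuousAt, h0, hR0] at h
    exact h.mono_left nhdsWithin_le_nhds
  · filter_upwards [hr.filter_mono nhdsWithin_le_nhds, self_mem_nhdsWithin] with w hw hw0 h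
    rw [Set.mem_singleton_iff.1 h, h0] at hw
    exact hw0 hw.symm

/-- The rational parametrization of the Cauchy transforms of the free powers `μₙ` of the two-point
measure: `G_{μₙ}(1 / fₙ(ρ)) = f₀(ρ)` where `fₙ` is `binomialParam p q n`. The parameter `ρ` is the
value of the `R`-transform of the two-point measure at `f₀(ρ)`. -/
noncomputable def binomialParam (p q : ℝ) (n : ℕ) (ρ : ℂ) : ℂ :=
  p * q * ρ / (1 - (q - p) * ρ + (n - 1) * (p * q) * ρ ^ 2)

theorem ofReal_mul_ne_zero {p q : ℝ} (hp : 0 < p) (hq : 0 < q) : (p : ℂ) * q ≠ 0 := by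
  exact_mod_cast (mul_pos hp hq).ne'

theorem exists_inverse_binomialParam {p q : ℝ} (hp : 0 < p) (hq : 0 < q) (n : ℕ) :
    ∃ R : ℂ → ℂ, Tendsto R (𝓝[≠] 0) (𝓝[≠] 0) ∧
      (∀ᶠ w in 𝓝[≠] 0, binomialParam p q n (R w) = w) ∧
      ∀ᶠ ρ in 𝓝[≠] 0, R (binomialParam p q n ρ) = ρ := by
  have hd : HasStrictDerivAt (fun ρ : ℂ => 1 - ((q : ℂ) - p) * ρ + (n - 1) * (p * q) * ρ ^ 2)
      (-((q : ℂ) - p)) 0 := by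
    have h1 := ((hasStrictDerivAt_id (0 : ℂ)).const_mul ((q : ℂ) - p)).const_sub 1
    have h2 := ((hasStrictDerivAt_id (0 : ℂ)).pow 2).const_mul (((n : ℂ) - 1) * (p * q))
    exact (h1.fun_add h2).congr_deriv (by simp)
  have hn : HasStrictDerivAt (fun ρ : ℂ => (p : ℂ) * q * ρ) (p * q) 0 := by
    simpa using (hasStrictDerivAt_id (0 : ℂ)).const_mul ((p : ℂ) * q)
  refine exists_inverse_nhdsNE (c := p * q) ?_ (ofReal_mul_ne_zero hp hq) (by simp [binomialParam])
  exact (hn.fun_div hd (by simp)).congr_deriv (by simp)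

theorem one_div_binomialParam {p q : ℝ} (hp : 0 < p) (hq : 0 < q) (n : ℕ) {ρ : ℂ} (hρ : ρ ≠ 0) :
    1 / binomialParam p q n ρ = 1 / binomialParam p q 0 ρ + n * ρ := by
  have hp' : (p : ℂ) ≠ 0 := by exact_mod_cast hp.ne'
  have hq' : (q : ℂ) ≠ 0 := by exact_mod_cast hq.ne'
  simp only [binomialParam, one_div_div]
  field_simp
  push_cast
  ring

/-- The Cauchy transform of the compactly supported probability measure `μ` is the one of the `n`-th
free power of the two-point measure, expressed through the parametrization `binomialParam`. -/
def HasBinomialTransform (p q : ℝ) (n : ℕ) (μ : Measure ℝ) : Prop :=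
  IsCompactProbability μ ∧ ∀ᶠ ρ in 𝓝[≠] (0 : ℂ),
    cauchyTransform μ (1 / binomialParam p q n ρ) = binomialParam p q 0 ρ

theorem tendsto_one_div_nhdsNE :
    Tendsto (fun w : ℂ => 1 / w) (𝓝[≠] 0) (Bornology.cobounded ℂ) := by
  simpa using tendsto_inv₀_nhdsNE_zero (α := ℂ)

theorem tendsto_one_div_cobounded :
    Tendsto (fun z : ℂ => 1 / z) (Bornology.cobounded ℂ) (𝓝[≠] 0) := by
  simpa using tendsto_inv₀_cobounded' (α := ℂ)

theorem tendsto_kFunction {R : ℂ → ℂ} (hR : Tendsto R (𝓝[≠] 0) (𝓝[≠] 0)) (n : ℕ) :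
    Tendsto (fun w : ℂ => 1 / w + n * R w) (𝓝[≠] 0) (Bornology.cobounded ℂ) := by
  rw [← tendsto_norm_atTop_iff_cobounded]
  have h1 := tendsto_norm_atTop_iff_cobounded.2 tendsto_one_div_nhdsNE
  have h2 : Tendsto (fun w => -‖(n : ℂ) * R w‖) (𝓝[≠] 0) (𝓝 (-‖(n : ℂ) * 0‖)) :=
    ((tendsto_nhds_of_tendsto_nhdsWithin hR).const_mul _).norm.neg
  refine tendsto_atTop_mono (fun w => ?_) (h1.atTop_add h2)
  have := norm_sub_le (1 / w + n * R w) (n * R w)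
  rw [add_sub_cancel_right] at this
  linarith

/-- If `R` inverts `f₀` near `0`, then `1 / w + n R(w)` is a `K`-function of any measure with the
Cauchy transform of the `n`-th free power. -/
theorem HasBinomialTransform.isKFunction {p q : ℝ} (hp : 0 < p) (hq : 0 < q) {n : ℕ}
    {μ : Measure ℝ} (h : HasBinomialTransform p q n μ) {R : ℂ → ℂ}
    (hR : Tendsto R (𝓝[≠] 0) (𝓝[≠] 0)) (hRr : ∀ᶠ w in 𝓝[≠] 0, binomialParam p q 0 (R w) = w)
    (hRl : ∀ᶠ ρ in 𝓝[≠] 0, R (binomialParam p q 0 ρ) = ρ) :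
    IsKFunction μ (fun w => 1 / w + n * R w) := by
  constructor
  · obtain ⟨S, hS, hSr, -⟩ := exists_inverse_binomialParam hp hq n
    have ht := tendsto_one_div_cobounded
    have hSt := hS.comp ht
    filter_upwards [hSt.eventually h.2, hSt.eventually hRl, ht.eventually hSr,
      hSt.eventually self_mem_nhdsWithin] with z h1 h2 h3 h4
    simp only [Function.comp_apply] at h1 h2 h4
    have hz : 1 / binomialParam p q n (S (1 / z)) = z := by rw [h3, one_div_one_div]
    rw [hz] at h1
    rw [h1, h2, ← one_div_binomialParam hp hq n h4, hz]
  · filter_upwards [hR.eventually h.2, hRr, hR.eventually self_mem_nhdsWithin] with w h1 h2 h3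
    rw [one_div_binomialParam hp hq n h3, h2] at h1
    exact h1

/-- On `K`-functions, adding the two-point measure adds the inverse `R` of `f₀` once more. -/
theorem HasBinomialTransform.isFreeConvolution_iff {p q : ℝ} (hp : 0 < p) (hq : 0 < q) {n : ℕ}
    {μ μ' μ'' : Measure ℝ} (h : HasBinomialTransform p q n μ) (h' : HasBinomialTransform p q 1 μ')
    (h'' : HasBinomialTransform p q (n + 1) μ'') {ν : Measure ℝ} :
    IsFreeConvolution μ μ' ν ↔ ν = μ'' := by
  obtain ⟨R, hR, hRr, hRl⟩ := exists_inverse_binomialParam hp hq 0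
  have k := h.isKFunction hp hq hR hRr hRl
  have k' := h'.isKFunction hp hq hR hRr hRl
  have k'' := h''.isKFunction hp hq hR hRr hRl
  constructor
  · rintro ⟨-, -, hν, K₁, K₂, K₃, h₁, h₂, h₃, hK⟩
    refine eq_of_isKFunction_eventuallyEq hν h''.1 h₃ k'' ?_
    filter_upwards [hK, k.eventuallyEq (tendsto_kFunction hR n) h₁,
      k'.eventuallyEq (tendsto_kFunction hR 1) h₂] with w e1 e2 e3
    rw [e1, e2, e3]
    push_cast
    ring
  · rintro rfl
    refine ⟨h.1, h'.1, h''.1, _, _, _, k, k', k'', Eventually.of_forall fun w => ?_⟩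
    push_cast
    ring

/-! ### The free powers of the two-point measure -/

/-- The mixture of two spiked semicircle laws which is, up to an affine change of variables, a free
power of the two-point measure. The parameter `r` is half the radius of the support of the
absolutely continuous part of that free power. -/
noncomputable def binomialMixture (p q r : ℝ) : Measure ℝ :=
  ENNReal.ofReal p • spikedSemicircle (-1 / (q * r)) +
    ENNReal.ofReal q • spikedSemicircle (1 / (p * r))

/-- Half the radius of the support of the absolutely continuous part of the `n`-th free power. -/
noncomputable def binomialRadius (p q : ℝ) (n : ℕ) : ℝ := √((n - 1) / (p * q))

/-- An explicit model of the `n`-th free power of the two-point measure. -/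
noncomputable def freeBinomial (p q : ℝ) : ℕ → Measure ℝ
  | 0 => Measure.dirac 0
  | 1 => twoPointMeasure p q
  | n + 2 => (binomialMixture p q (binomialRadius p q (n + 2))).map
      (fun u => binomialRadius p q (n + 2) * u - (q - p) / (p * q))

theorem isProbabilityMeasure_mixture {p q : ℝ} (hp : 0 < p) (hq : 0 < q) (hpq : p + q = 1)
    (μ ν : Measure ℝ) [IsProbabilityMeasure μ] [IsProbabilityMeasure ν] :
    IsProbabilityMeasure (ENNReal.ofReal p • μ + ENNReal.ofReal q • ν) := by
  refine ⟨?_⟩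
  simp only [Measure.add_apply, Measure.smul_apply, measure_univ, smul_eq_mul, mul_one]
  rw [← ENNReal.ofReal_add hp.le hq.le, hpq, ENNReal.ofReal_one]

theorem integral_mixture {p q : ℝ} (hp : 0 < p) (hq : 0 < q) {μ ν : Measure ℝ} {f : ℝ → ℂ}
    (hμ : Integrable f μ) (hν : Integrable f ν) :
    ∫ t, f t ∂(ENNReal.ofReal p • μ + ENNReal.ofReal q • ν) =
      p * ∫ t, f t ∂μ + q * ∫ t, f t ∂ν := by
  rw [integral_add_measure (hμ.smul_measure ENNReal.ofReal_ne_top)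
    (hν.smul_measure ENNReal.ofReal_ne_top), integral_smul_measure, integral_smul_measure,
    ENNReal.toReal_ofReal hp.le, ENNReal.toReal_ofReal hq.le, Complex.real_smul, Complex.real_smul]

theorem ae_mixture {p q : ℝ} {μ ν : Measure ℝ} {s : Set ℝ} (hμ : ∀ᵐ t ∂μ, t ∈ s)
    (hν : ∀ᵐ t ∂ν, t ∈ s) : ∀ᵐ t ∂(ENNReal.ofReal p • μ + ENNReal.ofReal q • ν), t ∈ s :=
  ae_add_measure_iff.2 ⟨Measure.ae_smul_measure hμ _, Measure.ae_smul_measure hν _⟩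

section

variable {p q : ℝ} (hp : 0 < p) (hq : 0 < q) (hpq : p + q = 1)
include hp hq hpq

theorem isProbabilityMeasure_binomialMixture (r : ℝ) :
    IsProbabilityMeasure (binomialMixture p q r) :=
  isProbabilityMeasure_mixture hp hq hpq _ _

theorem isProbabilityMeasure_twoPointMeasure : IsProbabilityMeasure (twoPointMeasure p q) :=
  isProbabilityMeasure_mixture hp hq hpq _ _

theorem isCompactProbability_freeBinomial (n : ℕ) :
    IsCompactProbability (freeBinomial p q n) := by
  match n with
  | 0 =>
    refine isCompactProbability_of_ae_mem (μ := Measure.dirac 0) (isCompact_singleton (x := 0)) ?_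
    simp [ae_dirac_eq]
  | 1 =>
    have := isProbabilityMeasure_twoPointMeasure hp hq hpq
    refine isCompactProbability_of_ae_mem (μ := twoPointMeasure p q) (s := {-1 / p, 1 / q})
      (Set.toFinite _).isCompact (ae_mixture ?_ ?_) <;> simp [ae_dirac_eq]
  | n + 2 =>
    have := isProbabilityMeasure_binomialMixture hp hq hpq (binomialRadius p q (n + 2))
    set r := binomialRadius p q (n + 2) with hr
    set K : Set ℝ := (Set.Icc (-2 : ℝ) 2 ∪ {-1 / (q * r) + 1 / (-1 / (q * r))}) ∪
      (Set.Icc (-2 : ℝ) 2 ∪ {1 / (p * r) + 1 / (1 / (p * r))}) with hK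
    have hKc : IsCompact K := (isCompact_Icc.union isCompact_singleton).union
      (isCompact_Icc.union isCompact_singleton)
    have hae : ∀ᵐ u ∂binomialMixture p q r, u ∈ K :=
      ae_mixture ((ae_spikedSemicircle_mem _).mono fun u hu => Or.inl hu)
        ((ae_spikedSemicircle_mem _).mono fun u hu => Or.inr hu)
    have hc : Continuous fun u : ℝ => r * u - (q - p) / (p * q) := by fun_prop
    have : IsProbabilityMeasure ((binomialMixture p q r).map
      fun u => r * u - (q - p) / (p * q)) := Measure.isProbabilityMeasure_map hc.aemeasurable
    refine isCompactProbability_of_ae_mem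
      (μ := (binomialMixture p q r).map fun u => r * u - (q - p) / (p * q)) (hKc.image hc) ?_
    exact (ae_map_iff (p := (· ∈ (fun u => r * u - (q - p) / (p * q)) '' K)) hc.aemeasurable
      (hKc.image hc).measurableSet).2 (hae.mono fun u hu => ⟨u, hu, rfl⟩)

end

theorem cauchyTransform_map_affine (μ : Measure ℝ) {r : ℝ} (hr : r ≠ 0) (b : ℝ) (z : ℂ) :
    cauchyTransform (μ.map fun u => r * u - b) (r * z - b) = 1 / r * cauchyTransform μ z := by
  have hr' : (r : ℂ) ≠ 0 := by exact_mod_cast hr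
  have he : MeasurableEmbedding fun u : ℝ => r * u - b :=
    ((Homeomorph.mulLeft₀ r hr).trans (Homeomorph.addRight (-b))).measurableEmbedding
  rw [cauchyTransform, he.integral_map, cauchyTransform, ← integral_const_mul]
  refine integral_congr_ae (ae_of_all _ fun u => ?_)
  simp only
  rw [one_div_mul_one_div]
  congr 1
  push_cast
  ring

theorem binomialRadius_sq {p q : ℝ} (hp : 0 < p) (hq : 0 < q) {n : ℕ} (hn : 1 ≤ n) :
    binomialRadius p q n ^ 2 = (n - 1) / (p * q) := by
  have : (1 : ℝ) ≤ n := by exact_mod_cast hn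
  exact Real.sq_sqrt (div_nonneg (by linarith) (mul_pos hp hq).le)

theorem binomialRadius_pos {p q : ℝ} (hp : 0 < p) (hq : 0 < q) {n : ℕ} (hn : 2 ≤ n) :
    0 < binomialRadius p q n := by
  have : (2 : ℝ) ≤ n := by exact_mod_cast hn
  exact Real.sqrt_pos.2 (div_pos (by linarith) (mul_pos hp hq))

theorem binomialParam_zero_eq {p q : ℝ} (hpq : p + q = 1) (ρ : ℂ)
    (h1 : 1 + p * ρ ≠ 0) (h2 : 1 - q * ρ ≠ 0) :
    binomialParam p q 0 ρ = p * q * ρ * (p / (1 + p * ρ) + q / (1 - q * ρ)) := by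
  have hpq' : (q : ℂ) = 1 - p := by
    rw [eq_sub_iff_add_eq, add_comm]; exact_mod_cast hpq
  have : 1 - ((q : ℂ) - p) * ρ + (((0 : ℕ) : ℂ) - 1) * (p * q) * ρ ^ 2 =
      (1 + p * ρ) * (1 - q * ρ) := by rw [hpq']; push_cast; ring
  rw [binomialParam, this, div_add_div _ _ h1 h2, ← mul_div_assoc]
  congr 1
  rw [hpq']
  ring

section

variable {p q : ℝ} (hp : 0 < p) (hq : 0 < q) (hpq : p + q = 1)
include hp hq hpq

/-- The substitution `ζ = p q r ρ` identifies the transform of the mixture with the one of the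
`n`-th free power. -/
theorem cauchyTransform_freeBinomial {n : ℕ} (hn : 2 ≤ n) {ρ ζ : ℂ} (hρ : ρ ≠ 0)
    (hζ : ζ = p * q * binomialRadius p q n * ρ) (hζ1 : ‖ζ‖ < 1)
    (h1 : 1 + p * ρ ≠ 0) (h2 : 1 - q * ρ ≠ 0)
    (h3 : ((-1 / (q * binomialRadius p q n) : ℝ) : ℂ) - ζ ≠ 0)
    (h4 : ((1 / (p * binomialRadius p q n) : ℝ) : ℂ) - ζ ≠ 0) :
    cauchyTransform (freeBinomial p q n) (1 / binomialParam p q n ρ) = binomialParam p q 0 ρ := by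
  obtain ⟨m, rfl⟩ := Nat.exists_eq_add_of_le' hn
  have hr := binomialRadius_pos hp hq hn
  have hr2 := binomialRadius_sq hp hq (by omega : 1 ≤ m + 2)
  rw [freeBinomial]
  set r := binomialRadius p q (m + 2)
  have hp' : (p : ℂ) ≠ 0 := by exact_mod_cast hp.ne'
  have hq' : (q : ℂ) ≠ 0 := by exact_mod_cast hq.ne'
  have hr' : (r : ℂ) ≠ 0 := by exact_mod_cast hr.ne'
  have hζ0 : ζ ≠ 0 := by
    rw [hζ]; exact mul_ne_zero (mul_ne_zero (mul_ne_zero hp' hq') hr') hρ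
  have hr2' : (r : ℂ) ^ 2 * (p * q) = ((m + 2 : ℕ) : ℂ) - 1 := by
    rw [eq_div_iff (mul_pos hp hq).ne'] at hr2
    exact_mod_cast hr2
  have hz : 1 / binomialParam p q (m + 2) ρ =
      r * (ζ + 1 / ζ) - (((q - p) / (p * q) : ℝ) : ℂ) := by
    rw [binomialParam, one_div_div, ← hr2', hζ]
    push_cast
    field_simp
    ring
  have e1 : 1 - ((-1 / (q * r) : ℝ) : ℂ) * ζ = 1 + p * ρ := by
    rw [hζ]; push_cast; field_simp; ring
  have e2 : 1 - ((1 / (p * r) : ℝ) : ℂ) * ζ = 1 - q * ρ := by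
    rw [hζ]; push_cast; field_simp
  have h1' := h1
  have h2' := h2
  rw [← e1] at h1'
  rw [← e2] at h2'
  rw [hz, cauchyTransform_map_affine _ hr.ne', cauchyTransform, binomialMixture,
    integral_mixture hp hq (integrable_one_div_sub_spikedSemicircle hζ0 hζ1 h3 h1')
      (integrable_one_div_sub_spikedSemicircle hζ0 hζ1 h4 h2')]
  have g1 := cauchyTransform_spikedSemicircle hζ0 hζ1 h3 h1'
  have g2 := cauchyTransform_spikedSemicircle hζ0 hζ1 h4 h2'
  rw [cauchyTransform] at g1 g2
  rw [g1, g2, e1, e2, binomialParam_zero_eq hpq ρ h1 h2, hζ]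
  field_simp

theorem cauchyTransform_twoPointMeasure {ρ : ℂ} (hρ : ρ ≠ 0) (h1 : 1 + p * ρ ≠ 0)
    (h2 : 1 - q * ρ ≠ 0) :
    cauchyTransform (twoPointMeasure p q) (1 / binomialParam p q 1 ρ) = binomialParam p q 0 ρ := by
  have hp' : (p : ℂ) ≠ 0 := by exact_mod_cast hp.ne'
  have hq' : (q : ℂ) ≠ 0 := by exact_mod_cast hq.ne'
  have hpq' : (q : ℂ) = 1 - p := by
    rw [eq_sub_iff_add_eq, add_comm]; exact_mod_cast hpq
  rw [cauchyTransform, twoPointMeasure, integral_mixture hp hq (integrable_dirac (by simp))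
    (integrable_dirac (by simp)), integral_dirac, integral_dirac,
    binomialParam_zero_eq hpq ρ h1 h2]
  have e1 : 1 / binomialParam p q 1 ρ - ((-1 / p : ℝ) : ℂ) = (1 + p * ρ) / (p * q * ρ) := by
    rw [binomialParam, one_div_div]; push_cast; field_simp; ring
  have e2 : 1 / binomialParam p q 1 ρ - ((1 / q : ℝ) : ℂ) = (1 - q * ρ) / (p * q * ρ) := by
    rw [binomialParam, one_div_div]; push_cast; field_simp; ring
  rw [e1, e2, one_div_div, one_div_div]
  ring

theorem hasBinomialTransform_freeBinomial (n : ℕ) :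
    HasBinomialTransform p q n (freeBinomial p q n) := by
  refine ⟨isCompactProbability_freeBinomial hp hq hpq n, ?_⟩
  have h1 : ∀ᶠ ρ : ℂ in 𝓝[≠] 0, 1 + p * ρ ≠ 0 :=
    nhdsWithin_le_nhds (ContinuousAt.eventually_ne (by fun_prop) (by simp))
  have h2 : ∀ᶠ ρ : ℂ in 𝓝[≠] 0, 1 - q * ρ ≠ 0 :=
    nhdsWithin_le_nhds (ContinuousAt.eventually_ne (by fun_prop) (by simp))
  match n with
  | 0 => exact Eventually.of_forall fun ρ => by simp [freeBinomial, cauchyTransform]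
  | 1 =>
    filter_upwards [h1, h2, self_mem_nhdsWithin] with ρ h1 h2 hρ
    exact cauchyTransform_twoPointMeasure hp hq hpq hρ h1 h2
  | n + 2 =>
    have hr := binomialRadius_pos hp hq (by omega : 2 ≤ n + 2)
    set r := binomialRadius p q (n + 2) with hr_def
    have h0 : ∀ᶠ ρ : ℂ in 𝓝[≠] 0, ‖(p : ℂ) * q * r * ρ‖ < 1 := by
      refine nhdsWithin_le_nhds (ContinuousAt.eventually_lt (by fun_prop) (by fun_prop) ?_)
      simp
    have h3 : ∀ᶠ ρ : ℂ in 𝓝[≠] 0, ((-1 / (q * r) : ℝ) : ℂ) - p * q * r * ρ ≠ 0 := by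
      refine nhdsWithin_le_nhds (ContinuousAt.eventually_ne (by fun_prop) ?_)
      simp [hq.ne', hr.ne']
    have h4 : ∀ᶠ ρ : ℂ in 𝓝[≠] 0, ((1 / (p * r) : ℝ) : ℂ) - p * q * r * ρ ≠ 0 := by
      refine nhdsWithin_le_nhds (ContinuousAt.eventually_ne (by fun_prop) ?_)
      simp [hp.ne', hr.ne']
    filter_upwards [h0, h1, h2, h3, h4, self_mem_nhdsWithin] with ρ h0 h1 h2 h3 h4 hρ
    exact cauchyTransform_freeBinomial hp hq hpq (by omega) hρ rfl h0 h1 h2 h3 h4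

theorem isFreeConvolution_freeBinomial_iff (n : ℕ) (ν : Measure ℝ) :
    IsFreeConvolution (freeBinomial p q n) (twoPointMeasure p q) ν ↔
      ν = freeBinomial p q (n + 1) :=
  (hasBinomialTransform_freeBinomial hp hq hpq n).isFreeConvolution_iff hp hq
    (hasBinomialTransform_freeBinomial hp hq hpq 1)
    (hasBinomialTransform_freeBinomial hp hq hpq (n + 1))

theorem freeConvolutionPower_eq_freeBinomial (n : ℕ) :
    freeConvolutionPower (twoPointMeasure p q) n = freeBinomial p q n := by
  induction n with
  | zero => rfl
  | succ n ih =>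
    have hex : ∃ ν, IsFreeConvolution (freeBinomial p q n) (twoPointMeasure p q) ν :=
      ⟨_, (isFreeConvolution_freeBinomial_iff hp hq hpq n _).2 rfl⟩
    rw [freeConvolutionPower, ih, freeConvolution, dif_pos hex]
    exact (isFreeConvolution_freeBinomial_iff hp hq hpq n _).1 hex.choose_spec

end

/-! ### Kolmogorov distance and the upper bound -/

theorem bddAbove_cdf_sub (μ ν : Measure ℝ) :
    BddAbove (Set.range fun x : ℝ => |cdf μ x - cdf ν x|) := by
  refine ⟨1, ?_⟩
  rintro _ ⟨x, rfl⟩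
  exact abs_le.2 ⟨by linarith [cdf_nonneg μ x, cdf_le_one ν x],
    by linarith [cdf_nonneg ν x, cdf_le_one μ x]⟩

theorem abs_cdf_sub_le_kolmogorovDist (μ ν : Measure ℝ) (x : ℝ) :
    |cdf μ x - cdf ν x| ≤ kolmogorovDist μ ν :=
  le_ciSup (bddAbove_cdf_sub μ ν) x

theorem kolmogorovDist_le {μ ν : Measure ℝ} {c : ℝ} (h : ∀ x, |cdf μ x - cdf ν x| ≤ c) :
    kolmogorovDist μ ν ≤ c :=
  ciSup_le h

theorem kolmogorovDist_nonneg (μ ν : Measure ℝ) : 0 ≤ kolmogorovDist μ ν :=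
  (abs_nonneg _).trans (abs_cdf_sub_le_kolmogorovDist μ ν 0)

theorem eq_of_kolmogorovDist_eq_zero {μ ν : Measure ℝ} [IsProbabilityMeasure μ]
    [IsProbabilityMeasure ν] (h : kolmogorovDist μ ν = 0) : μ = ν := by
  refine Measure.eq_of_cdf μ ν (StieltjesFunction.ext fun x => ?_)
  have := abs_cdf_sub_le_kolmogorovDist μ ν x
  rw [h] at this
  exact sub_eq_zero.1 (abs_nonpos_iff.1 this)

theorem semicircleLaw_Ioc_le (x y : ℝ) :
    semicircleLaw (Set.Ioc x y) ≤ ENNReal.ofReal (y - x) := by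
  rw [semicircleLaw, withDensity_apply _ measurableSet_Ioc, ← Real.volume_Ioc]
  calc ∫⁻ t in Set.Ioc x y, ENNReal.ofReal (√(4 - t ^ 2) / (2 * Real.pi))
      ≤ ∫⁻ _ in Set.Ioc x y, 1 := by
        refine lintegral_mono fun t => ?_
        rw [ENNReal.ofReal_le_one, div_le_one (by positivity)]
        have : √(4 - t ^ 2) ≤ 2 := Real.sqrt_le_iff.2 ⟨by norm_num, by nlinarith [sq_nonneg t]⟩
        linarith [Real.pi_gt_three]
    _ = volume (Set.Ioc x y) := by simp

theorem cdf_semicircleLaw_sub_le {x y : ℝ} (h : x ≤ y) :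
    cdf semicircleLaw y - cdf semicircleLaw x ≤ y - x := by
  rw [cdf_eq_real, cdf_eq_real, ← measureReal_sdiff (Set.Iic_subset_Iic.2 h) measurableSet_Iic,
    Set.Iic_sdiff_Iic]
  exact ENNReal.toReal_le_of_le_ofReal (by linarith) (semicircleLaw_Ioc_le x y)

theorem abs_cdf_semicircleLaw_sub_le (x y : ℝ) :
    |cdf semicircleLaw x - cdf semicircleLaw y| ≤ |x - y| := by
  rcases le_total x y with h | h
  · rw [abs_sub_comm, abs_sub_comm x, abs_of_nonneg (sub_nonneg.2 (monotone_cdf _ h)),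
      abs_of_nonneg (sub_nonneg.2 h)]
    exact cdf_semicircleLaw_sub_le h
  · rw [abs_of_nonneg (sub_nonneg.2 (monotone_cdf _ h)), abs_of_nonneg (sub_nonneg.2 h)]
    exact cdf_semicircleLaw_sub_le h

theorem cdf_semicircleLaw_of_two_le {x : ℝ} (hx : 2 ≤ x) : cdf semicircleLaw x = 1 := by
  have : semicircleLaw (Set.Iic x) = 1 := by
    rw [← prob_compl_eq_zero_iff measurableSet_Iic]
    refine measure_mono_null (fun t ht => ?_) (ae_iff.1 ae_semicircleLaw_mem)
    exact fun h => ht (h.2.le.trans hx)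
  rw [cdf_eq_real, measureReal_def, this, ENNReal.toReal_one]

theorem cdf_semicircleLaw_of_le_neg_two {x : ℝ} (hx : x ≤ -2) : cdf semicircleLaw x = 0 := by
  rw [cdf_eq_real, measureReal_def]
  have : semicircleLaw (Set.Iic x) = 0 := by
    refine measure_mono_null (fun t ht => ?_) (ae_iff.1 ae_semicircleLaw_mem)
    exact fun h => by linarith [h.1, Set.mem_Iic.1 ht]
  rw [this, ENNReal.toReal_zero]

/-- The distribution function of the semicircle law moves by little under an affine change of
variables close to the identity; outside `[-2, 2]` this is by monotonicity. -/
theorem abs_cdf_semicircleLaw_affine_sub_le {κ b : ℝ} (hκ : 1 ≤ κ) (x : ℝ) :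
    |cdf semicircleLaw (κ * x + b) - cdf semicircleLaw x| ≤ 2 * (κ - 1) + |b| := by
  have hb := neg_abs_le b
  have hb' := le_abs_self b
  rcases le_or_gt x (-2) with h | h
  · rw [cdf_semicircleLaw_of_le_neg_two h, sub_zero, abs_of_nonneg (cdf_nonneg _ _)]
    have h1 : cdf semicircleLaw (κ * x + b) ≤ cdf semicircleLaw (-2 + |b|) :=
      monotone_cdf _ (by nlinarith)
    have h2 := cdf_semicircleLaw_sub_le (x := -2) (y := -2 + |b|) (by linarith [abs_nonneg b])
    rw [cdf_semicircleLaw_of_le_neg_two le_rfl] at h2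
    linarith
  rcases le_or_gt 2 x with h' | h'
  · rw [cdf_semicircleLaw_of_two_le h', abs_sub_comm,
      abs_of_nonneg (by linarith [cdf_le_one semicircleLaw (κ * x + b)])]
    have h1 : cdf semicircleLaw (2 - |b|) ≤ cdf semicircleLaw (κ * x + b) :=
      monotone_cdf _ (by nlinarith)
    have h2 := cdf_semicircleLaw_sub_le (x := 2 - |b|) (y := 2) (by linarith [abs_nonneg b])
    rw [cdf_semicircleLaw_of_two_le le_rfl] at h2
    linarith
  · refine (abs_cdf_semicircleLaw_sub_le _ _).trans ?_
    rw [show κ * x + b - x = (κ - 1) * x + b by ring]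
    refine (abs_add_le _ _).trans ?_
    rw [abs_mul, abs_of_nonneg (by linarith : 0 ≤ κ - 1)]
    have : |x| ≤ 2 := abs_le.2 ⟨h.le, h'.le⟩
    nlinarith

theorem abs_kernel_sub_one_le {β u : ℝ} (hβ : |β| ≤ 1 / 4) (hu : u ∈ Set.Ioo (-2 : ℝ) 2) :
    |1 / (1 + β ^ 2 - β * u) - 1| ≤ 5 * |β| := by
  have hu2 : |u| ≤ 2 := abs_le.2 ⟨hu.1.le, hu.2.le⟩
  have h1 : |β * u| ≤ 2 * |β| := by rw [abs_mul]; nlinarith [abs_nonneg β]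
  have h2 := abs_le.1 h1
  have hd : 1 / 2 ≤ 1 + β ^ 2 - β * u := by nlinarith [sq_nonneg β]
  have : 1 / (1 + β ^ 2 - β * u) - 1 = (β * u - β ^ 2) / (1 + β ^ 2 - β * u) := by
    rw [eq_div_iff (by linarith), sub_mul, div_mul_cancel₀ _ (by linarith)]
    ring
  rw [this, abs_div, abs_of_pos (by linarith : 0 < 1 + β ^ 2 - β * u), div_le_iff₀ (by linarith)]
  have h3 : |β * u - β ^ 2| ≤ 2 * |β| + |β| ^ 2 := by
    refine (abs_sub _ _).trans ?_
    rw [abs_pow]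
    linarith
  nlinarith [abs_nonneg β]

theorem measureReal_spikedSemicircle_sub_le {β : ℝ} (hβ : |β| ≤ 1 / 4) (x : ℝ) :
    |(spikedSemicircle β).real (Set.Iic x) - cdf semicircleLaw x| ≤ 5 * |β| := by
  have h1 : (spikedSemicircle β).real (Set.Iic x) =
      ∫ u in Set.Iic x, 1 / (1 + β ^ 2 - β * u) ∂semicircleLaw := by
    rw [spikedSemicircle, spikeMass_of_abs_le (by linarith), ENNReal.ofReal_zero, zero_smul,
      add_zero, measureReal_def, withDensity_apply _ measurableSet_Iic,
      ← ofReal_integral_eq_lintegral_ofReal (integrable_kernel β).integrableOn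
        (ae_restrict_of_ae (kernel_nonneg_ae β)), ENNReal.toReal_ofReal]
    exact integral_nonneg_of_ae (ae_restrict_of_ae (kernel_nonneg_ae β))
  have h2 : cdf semicircleLaw x = ∫ u in Set.Iic x, (1 : ℝ) ∂semicircleLaw := by
    rw [cdf_eq_real]; simp
  rw [h1, h2, ← integral_sub (integrable_kernel β).integrableOn (integrable_const _)]
  have h3 := norm_integral_le_of_norm_le_const (μ := semicircleLaw.restrict (Set.Iic x))
    (C := 5 * |β|) (f := fun u => 1 / (1 + β ^ 2 - β * u) - 1)
    (ae_restrict_of_ae (ae_semicircleLaw_mem.mono fun u hu => abs_kernel_sub_one_le hβ hu))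
  rw [Real.norm_eq_abs] at h3
  refine h3.trans (mul_le_of_le_one_right (by positivity) ?_)
  simp

theorem eventually_le_mul_sqrt (C : ℝ) {c : ℝ} (hc : 0 < c) : ∀ᶠ n : ℕ in atTop, C ≤ c * √n := by
  have : Tendsto (fun n : ℕ => c * √(n : ℝ)) atTop atTop :=
    (Real.tendsto_sqrt_atTop.comp tendsto_natCast_atTop_atTop).const_mul_atTop hc
  exact this.eventually_ge_atTop C

theorem sqrt_div_le_add_binomialRadius {p q : ℝ} (hp : 0 < p) (hq : 0 < q) {n : ℕ} (hn : 1 ≤ n) :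
    √(n / (p * q)) ≤ binomialRadius p q n + √(1 / (p * q)) := by
  have h1 : (1 : ℝ) ≤ n := by exact_mod_cast hn
  have h2 := binomialRadius_sq hp hq hn
  have h3 : √(1 / (p * q)) ^ 2 = 1 / (p * q) := Real.sq_sqrt (by positivity)
  have h4 : 0 ≤ binomialRadius p q n := Real.sqrt_nonneg _
  have h5 : (n : ℝ) / (p * q) = (n - 1) / (p * q) + 1 / (p * q) := by ring
  rw [Real.sqrt_le_left (by positivity), add_sq, h2, h3, h5]
  have : 0 ≤ 2 * binomialRadius p q n * √(1 / (p * q)) := by positivity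
  linarith

theorem binomialRadius_le_sqrt_div {p q : ℝ} (hp : 0 < p) (hq : 0 < q) (n : ℕ) :
    binomialRadius p q n ≤ √(n / (p * q)) := by
  refine Real.sqrt_le_sqrt ?_
  gcongr
  linarith

section

variable {p q : ℝ} (hp : 0 < p) (hq : 0 < q) (hpq : p + q = 1)
include hp hq hpq

theorem measureReal_binomialMixture_sub_le {r : ℝ} (hr : 0 < r) (h1 : 1 / (q * r) ≤ 1 / 4)
    (h2 : 1 / (p * r) ≤ 1 / 4) (x : ℝ) :
    |(binomialMixture p q r).real (Set.Iic x) - cdf semicircleLaw x| ≤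
      5 * (p / q + q / p) / r := by
  have e1 : |(-1) / (q * r)| = 1 / (q * r) := by
    rw [abs_div, abs_neg, abs_one, abs_of_pos (by positivity)]
  have e2 : |1 / (p * r)| = 1 / (p * r) := abs_of_pos (by positivity)
  have b1 := measureReal_spikedSemicircle_sub_le (e1.le.trans h1) x
  have b2 := measureReal_spikedSemicircle_sub_le (e2.le.trans h2) x
  have hm : (binomialMixture p q r).real (Set.Iic x) =
      p * (spikedSemicircle (-1 / (q * r))).real (Set.Iic x) +
        q * (spikedSemicircle (1 / (p * r))).real (Set.Iic x) := by
    have := isProbabilityMeasure_binomialMixture hp hq hpq r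
    rw [binomialMixture, measureReal_def, Measure.add_apply, Measure.smul_apply,
      Measure.smul_apply, smul_eq_mul, smul_eq_mul, ENNReal.toReal_add (by finiteness)
      (by finiteness), ENNReal.toReal_mul, ENNReal.toReal_mul, ENNReal.toReal_ofReal hp.le,
      ENNReal.toReal_ofReal hq.le]
    rfl
  rw [hm]
  set A := (spikedSemicircle (-1 / (q * r))).real (Set.Iic x)
  set B := (spikedSemicircle (1 / (p * r))).real (Set.Iic x)
  set F := cdf semicircleLaw x
  have : p * A + q * B - F = p * (A - F) + q * (B - F) := by
    linear_combination F * hpq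
  rw [this]
  refine (abs_add_le _ _).trans ?_
  rw [abs_mul, abs_mul, abs_of_pos hp, abs_of_pos hq]
  calc p * |A - F| + q * |B - F| ≤ p * (5 * (1 / (q * r))) + q * (5 * (1 / (p * r))) := by
        rw [e1] at b1; rw [e2] at b2; gcongr
    _ = 5 * (p / q + q / p) / r := by field_simp

theorem sqrt_le_binomialRadius {n : ℕ} (hn : 2 ≤ n) : √n ≤ binomialRadius p q n := by
  have h2 : (2 : ℝ) ≤ n := by exact_mod_cast hn
  refine Real.sqrt_le_sqrt ?_
  rw [le_div_iff₀ (by positivity)]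
  have : p * q ≤ 1 / 4 := by nlinarith [sq_nonneg (p - q)]
  nlinarith

theorem isProbabilityMeasure_normalizedPower (n : ℕ) :
    IsProbabilityMeasure (normalizedPower p q n) := by
  have := (isCompactProbability_freeBinomial hp hq hpq n).1
  rw [normalizedPower, freeConvolutionPower_eq_freeBinomial hp hq hpq]
  exact Measure.isProbabilityMeasure_map (by fun_prop)

theorem normalizedPower_eq_map {n : ℕ} (hn : 2 ≤ n) :
    normalizedPower p q n = (binomialMixture p q (binomialRadius p q n)).map
      fun u => (binomialRadius p q n * u - (q - p) / (p * q)) / √(n / (p * q)) := by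
  rw [normalizedPower, freeConvolutionPower_eq_freeBinomial hp hq hpq]
  obtain ⟨m, rfl⟩ := Nat.exists_eq_add_of_le' hn
  rw [freeBinomial, Measure.map_map (by fun_prop) (by fun_prop)]
  rfl

theorem cdf_normalizedPower {n : ℕ} (hn : 2 ≤ n) (x : ℝ) :
    cdf (normalizedPower p q n) x = (binomialMixture p q (binomialRadius p q n)).real
      (Set.Iic (√(n / (p * q)) / binomialRadius p q n * x +
        (q - p) / (p * q) / binomialRadius p q n)) := by
  have := isProbabilityMeasure_normalizedPower hp hq hpq n
  have hr := binomialRadius_pos hp hq hn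
  have hs : 0 < √(n / (p * q)) := hr.trans_le (binomialRadius_le_sqrt_div hp hq n)
  rw [cdf_eq_real, normalizedPower_eq_map hp hq hpq hn, measureReal_def,
    Measure.map_apply (by fun_prop) measurableSet_Iic, measureReal_def]
  congr 2
  ext u
  simp only [Set.mem_preimage, Set.mem_Iic]
  set r := binomialRadius p q n
  rw [div_le_iff₀ hs, div_mul_eq_mul_div, ← add_div, le_div_iff₀ hr]
  constructor <;> intro h <;> linarith

theorem exists_upper_bound : ∃ C : ℝ, ∀ᶠ n : ℕ in atTop,
    kolmogorovDist (normalizedPower p q n) semicircleLaw * √n ≤ C := by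
  refine ⟨5 * (p / q + q / p) + 2 * √(1 / (p * q)) + |(q - p) / (p * q)|, ?_⟩
  filter_upwards [eventually_ge_atTop 2, eventually_le_mul_sqrt 4 hq,
    eventually_le_mul_sqrt 4 hp] with n hn hnq hnp
  have hr := binomialRadius_pos hp hq hn
  have hnr := sqrt_le_binomialRadius hp hq hpq hn
  have hsr := sqrt_div_le_add_binomialRadius hp hq (by omega : 1 ≤ n)
  have hrs := binomialRadius_le_sqrt_div hp hq n
  have hn0 : 0 < √(n : ℝ) := Real.sqrt_pos.2 (by positivity)
  have hcdf := cdf_normalizedPower hp hq hpq hn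
  set r := binomialRadius p q n
  set s := √(n / (p * q))
  have h1 : 1 / (q * r) ≤ 1 / 4 :=
    one_div_le_one_div_of_le (by norm_num) (hnq.trans (by gcongr))
  have h2 : 1 / (p * r) ≤ 1 / 4 :=
    one_div_le_one_div_of_le (by norm_num) (hnp.trans (by gcongr))
  rw [← le_div_iff₀ hn0]
  refine kolmogorovDist_le fun x => ?_
  rw [hcdf x]
  set x' := s / r * x + (q - p) / (p * q) / r
  have hκ : 1 ≤ s / r := (one_le_div hr).2 hrs
  have b1 := measureReal_binomialMixture_sub_le hp hq hpq hr h1 h2 x'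
  have b2 := abs_cdf_semicircleLaw_affine_sub_le (b := (q - p) / (p * q) / r) hκ x
  have b3 : s / r - 1 ≤ √(1 / (p * q)) / r := by
    rw [sub_le_iff_le_add, div_add_one hr.ne']
    gcongr
    linarith
  rw [abs_div _ r, abs_of_pos hr] at b2
  calc _ ≤ _ := abs_sub_le _ (cdf semicircleLaw x') _
    _ ≤ 5 * (p / q + q / p) / r + (2 * (√(1 / (p * q)) / r) + |(q - p) / (p * q)| / r) := by
      linarith
    _ = (5 * (p / q + q / p) + 2 * √(1 / (p * q)) + |(q - p) / (p * q)|) / r := by ring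
    _ ≤ _ := by gcongr

end

/-! ### The lower bound -/

/-- The layer cake formula: for `0 < s < 1 / (y - L)`, the set `s < 1 / (y - t)` is `t > y - 1 / s`. -/
theorem integral_one_div_sub_eq_integral_tail {μ : Measure ℝ} [IsProbabilityMeasure μ] {L y : ℝ}
    (hL : L < y) (hμ : ∀ᵐ t ∂μ, t ≤ L) :
    ∫ t, 1 / (y - t) ∂μ = ∫ s in (0 : ℝ)..1 / (y - L), (1 - cdf μ (y - 1 / s)) := by
  have hM : 0 < 1 / (y - L) := one_div_pos.2 (sub_pos.2 hL)
  have hae : (fun t => 1 / (y - t)) =ᵐ[μ] fun t => 1 / (y - min t L) := by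
    filter_upwards [hμ] with t ht
    rw [min_eq_left ht]
  have hpos : ∀ t : ℝ, 0 < y - min t L := fun t => by linarith [min_le_right t L]
  have hle : ∀ t : ℝ, 1 / (y - min t L) ≤ 1 / (y - L) := fun t =>
    one_div_le_one_div_of_le (sub_pos.2 hL) (by linarith [min_le_right t L])
  -- truncating `t` at `L` changes nothing almost everywhere and makes the integrand bounded
  have hint : Integrable (fun t => 1 / (y - min t L)) μ := by
    refine Integrable.of_bound (Measurable.aestronglyMeasurable (by fun_prop)) (1 / (y - L))
      (ae_of_all _ fun t => ?_)
    rw [Real.norm_of_nonneg (one_div_pos.2 (hpos t)).le]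
    exact hle t
  rw [integral_congr_ae hae, hint.integral_eq_integral_meas_lt
      (ae_of_all _ fun t => (one_div_pos.2 (hpos t)).le), intervalIntegral.integral_of_le hM.le,
    integral_Ioc_eq_integral_Ioo, setIntegral_eq_of_subset_of_forall_sdiff_eq_zero
      measurableSet_Ioi (Set.Ioo_subset_Ioi_self : Set.Ioo (0 : ℝ) (1 / (y - L)) ⊆ Set.Ioi 0)]
  · refine setIntegral_congr_fun measurableSet_Ioo fun s hs => ?_
    have hset : {t | s < 1 / (y - min t L)} = (Set.Iic (y - 1 / s))ᶜ := by
      ext t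
      simp only [Set.mem_ofPred_eq, Set.mem_compl_iff, Set.mem_Iic, not_le]
      rw [lt_one_div hs.1 (hpos t)]
      have : y - L < 1 / s := (lt_one_div hs.1 (sub_pos.2 hL)).1 hs.2
      rcases le_total t L with h | h
      · rw [min_eq_left h]; constructor <;> intro h' <;> linarith
      · rw [min_eq_right h]; constructor <;> intro h' <;> linarith
    rw [hset, probReal_compl_eq_one_sub measurableSet_Iic, cdf_eq_real]
  · intro s hs
    have : {t | s < 1 / (y - min t L)} = ∅ := by
      ext t
      simp only [Set.mem_ofPred_eq, Set.mem_empty_iff_false, iff_false, not_lt]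
      refine (hle t).trans ?_
      by_contra! h
      exact hs.2 ⟨hs.1, h⟩
    rw [this, measureReal_empty]

theorem intervalIntegrable_tail (μ : Measure ℝ) (y M : ℝ) :
    IntervalIntegrable (fun s => 1 - cdf μ (y - 1 / s)) volume 0 M := by
  refine (intervalIntegrable_const (c := (1 : ℝ))).mono_fun
    (Measurable.aestronglyMeasurable ?_) (ae_of_all _ fun s => ?_)
  · exact measurable_const.sub ((monotone_cdf μ).measurable.comp (by fun_prop))
  · simp only [norm_one]
    rw [Real.norm_of_nonneg (by linarith [cdf_le_one μ (y - 1 / s)])]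
    linarith [cdf_nonneg μ (y - 1 / s)]

/-- To the right of both supports the Cauchy transform is an average of tail probabilities, hence it
is controlled by the Kolmogorov distance. -/
theorem abs_integral_sub_le_kolmogorovDist {μ ν : Measure ℝ} [IsProbabilityMeasure μ]
    [IsProbabilityMeasure ν] {L y : ℝ} (hL : L < y) (hμ : ∀ᵐ t ∂μ, t ≤ L) (hν : ∀ᵐ t ∂ν, t ≤ L) :
    |∫ t, 1 / (y - t) ∂μ - ∫ t, 1 / (y - t) ∂ν| ≤ kolmogorovDist μ ν / (y - L) := by
  have hM : 0 < 1 / (y - L) := one_div_pos.2 (sub_pos.2 hL)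
  rw [integral_one_div_sub_eq_integral_tail hL hμ, integral_one_div_sub_eq_integral_tail hL hν,
    ← intervalIntegral.integral_sub (intervalIntegrable_tail μ y _) (intervalIntegrable_tail ν y _)]
  have := intervalIntegral.norm_integral_le_of_norm_le_const (a := 0) (b := 1 / (y - L))
    (C := kolmogorovDist μ ν)
    (f := fun s => 1 - cdf μ (y - 1 / s) - (1 - cdf ν (y - 1 / s))) (fun s _ => by
      rw [Real.norm_eq_abs, sub_sub_sub_cancel_left, abs_sub_comm]
      exact abs_cdf_sub_le_kolmogorovDist μ ν _)
  rw [Real.norm_eq_abs, sub_zero, abs_of_pos hM, mul_one_div] at this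
  exact this

/-- One of the two roots of `x² - z x + 1`, whose product is `1`, lies in the open unit disc unless
both lie on the unit circle, where `‖z‖ ≤ 2`. -/
theorem exists_joukowski_preimage {z : ℂ} (hz : 2 < ‖z‖) :
    ∃ ζ : ℂ, ζ ≠ 0 ∧ ‖ζ‖ < 1 ∧ ζ + 1 / ζ = z := by
  obtain ⟨s, hs⟩ := IsAlgClosed.exists_pow_nat_eq (z ^ 2 - 4) (n := 2) two_pos
  set x := (z + s) / 2 with hx
  have hroot : x * (z - x) = 1 := by rw [hx]; linear_combination (-1 / 4) * hs
  have hx0 : x ≠ 0 := left_ne_zero_of_mul_eq_one hroot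
  have hinv : 1 / x = z - x := by rw [div_eq_iff hx0, mul_comm, hroot]
  rcases lt_trichotomy ‖x‖ 1 with h | h | h
  · exact ⟨x, hx0, h, by rw [hinv]; ring⟩
  · exfalso
    have h1 : ‖x + 1 / x‖ ≤ ‖x‖ + ‖1 / x‖ := norm_add_le _ _
    have h2 : ‖1 / x‖ = 1 := by rw [norm_div, norm_one, h, div_one]
    rw [h2, hinv, add_sub_cancel, h] at h1
    linarith
  · refine ⟨1 / x, one_div_ne_zero hx0, ?_, by rw [one_div_one_div, hinv]; ring⟩
    rw [norm_div, norm_one]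
    exact (div_lt_one (by linarith)).2 h

/-- The quadratic equation of the semicircle law. -/
theorem cauchyTransform_semicircleLaw_spec {z : ℂ} (hz : 2 < ‖z‖) :
    cauchyTransform semicircleLaw z ≠ 0 ∧ ‖cauchyTransform semicircleLaw z‖ < 1 ∧
      cauchyTransform semicircleLaw z + 1 / cauchyTransform semicircleLaw z = z := by
  obtain ⟨ζ, h0, h1, rfl⟩ := exists_joukowski_preimage hz
  rw [cauchyTransform_semicircleLaw h0 h1]
  exact ⟨h0, h1, rfl⟩

theorem transform_point_bounds {w η : ℝ} (hη_le : |η| ≤ 1 / 2) (hw : w = 1 / 8 / (1 - η)) :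
    1 / 12 ≤ w ∧ 4 ≤ 1 / w + 1 / 8 ∧ 1 / w + 1 / 8 ≤ 13 := by
  have hηb := abs_le.1 hη_le
  have hpos : 0 < 1 - η := by linarith
  have hw1 : 1 / 12 ≤ w := by rw [hw, le_div_iff₀ hpos]; linarith
  have e : 1 / w = 8 * (1 - η) := by rw [hw]; field_simp
  exact ⟨hw1, by rw [e]; linarith, by rw [e]; linarith⟩

/-- If `w₀ + 1 / w₀` and `w + 1 / w` differ by `w - 1 / 8 = w η`, then `w - w₀` is at least of the
order of `η`. -/
theorem mul_abs_le_abs_sub {w η w₀ : ℝ} (hη_le : |η| ≤ 1 / 2) (hw : w = 1 / 8 / (1 - η))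
    (h0 : w₀ ≠ 0) (h1 : |w₀| < 1) (h2 : w₀ + 1 / w₀ = 1 / w + 1 / 8) :
    (1 / 12) ^ 2 * (1 / 13) * |η| ≤ |w - w₀| := by
  obtain ⟨hw1, hy1, hy2⟩ := transform_point_bounds hη_le hw
  have hηb := abs_le.1 hη_le
  have hpos : 0 < 1 - η := by linarith
  have hw2 : w ≤ 1 / 4 := by rw [hw, div_le_iff₀ hpos]; linarith
  have hwη : w - 1 / 8 = w * η := by
    have : w * (1 - η) = 1 / 8 := by rw [hw, div_mul_cancel₀ _ hpos.ne']
    linarith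
  have hw0 : 0 < w := by linarith
  clear hw
  have h0' : 0 < w₀ := by
    by_contra! h
    have := one_div_nonpos.2 h
    linarith
  have h3 : 1 / 13 ≤ w₀ := by
    have : 1 / w₀ ≤ 13 := by linarith
    rw [div_le_iff₀ h0'] at this
    linarith
  have h4 := (abs_lt.1 h1).2
  have key : (w - w₀) * (w * w₀ - 1) = w ^ 2 * w₀ * η := by
    have e1 : w * (w₀ ^ 2 + 1) = (1 + 1 / 8 * w) * w₀ := by
      field_simp at h2
      linear_combination h2 / 8
    linear_combination (-1) * e1 + w₀ * w * hwη
  have h5 : |w * w₀ - 1| ≤ 1 := abs_le.2 ⟨by nlinarith, by nlinarith⟩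
  have key2 : w ^ 2 * w₀ * |η| ≤ |w - w₀| := by
    rw [← abs_of_pos (by positivity : 0 < w ^ 2 * w₀), ← abs_mul, ← key, abs_mul]
    exact mul_le_of_le_one_right (abs_nonneg _) h5
  refine le_trans ?_ key2
  gcongr

section

variable {p q : ℝ} (hp : 0 < p) (hq : 0 < q) (hpq : p + q = 1)
include hp hq hpq

theorem cauchyTransform_normalizedPower {n : ℕ} (hn : 1 ≤ n) (z : ℂ) :
    cauchyTransform (normalizedPower p q n) (z / √(n / (p * q))) =
      √(n / (p * q)) * cauchyTransform (freeBinomial p q n) z := by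
  have hs : 0 < √(n / (p * q)) := Real.sqrt_pos.2 (by positivity)
  have h := cauchyTransform_map_affine (freeBinomial p q n) (one_div_ne_zero hs.ne') 0 z
  rw [normalizedPower, freeConvolutionPower_eq_freeBinomial hp hq hpq]
  have e : (fun x : ℝ => x / √(n / (p * q))) = fun u => 1 / √(n / (p * q)) * u - 0 := by
    funext u; ring
  rw [e]
  push_cast at h
  rw [one_div_one_div, sub_zero, one_div_mul_eq_div] at h
  exact h

/-- If a rescaled power were the semicircle law, then `f₀` would be linear near `0`; it is not, as
`p ≠ q`. -/
theorem kolmogorovDist_normalizedPower_pos (hne : p ≠ q) {n : ℕ} (hn : 1 ≤ n) :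
    0 < kolmogorovDist (normalizedPower p q n) semicircleLaw := by
  refine lt_of_le_of_ne (kolmogorovDist_nonneg _ _) fun h => ?_
  have := isProbabilityMeasure_normalizedPower hp hq hpq n
  have heq := eq_of_kolmogorovDist_eq_zero h.symm
  have hs : 0 < √(n / (p * q)) := Real.sqrt_pos.2 (by positivity)
  have hs2 : √(n / (p * q)) ^ 2 = n / (p * q) := Real.sq_sqrt (by positivity)
  have hc := cauchyTransform_normalizedPower hp hq hpq hn
  rw [heq] at hc
  set s := √(n / (p * q))
  have hs' : (s : ℂ) ≠ 0 := by exact_mod_cast hs.ne'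
  have hp' : (p : ℂ) ≠ 0 := by exact_mod_cast hp.ne'
  have hq' : (q : ℂ) ≠ 0 := by exact_mod_cast hq.ne'
  have hs2' : (s : ℂ) ^ 2 * (p * q) = n := by
    rw [eq_div_iff (by positivity)] at hs2
    exact_mod_cast hs2
  have hne' : (q : ℂ) - p ≠ 0 := by
    rw [sub_ne_zero]; exact_mod_cast hne.symm
  -- `f₀(ρ) = p q ρ` forces this expression to vanish
  have h1 : ∀ᶠ ρ in 𝓝[≠] (0 : ℂ), ((q : ℂ) - p) + p * q * ρ ≠ 0 :=
    nhdsWithin_le_nhds (ContinuousAt.eventually_ne (by fun_prop) (by simpa using hne'))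
  obtain ⟨R, hR, hRr, -⟩ := exists_inverse_binomialParam hp hq n
  have hz : ∀ᶠ w : ℂ in 𝓝[≠] 0, 2 < ‖1 / w / (s : ℂ)‖ := by
    have := (tendsto_norm_atTop_iff_cobounded.2 tendsto_one_div_nhdsNE).eventually_gt_atTop (2 * s)
    filter_upwards [this] with w hw
    rwa [norm_div, Complex.norm_real, Real.norm_of_nonneg hs.le, lt_div_iff₀ hs]
  obtain ⟨w, hw1, hw2, hw3, hw4, hw5⟩ := (hRr.and <| (hz.and <|
    (hR.eventually (hasBinomialTransform_freeBinomial hp hq hpq n).2).and <|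
    (hR.eventually h1).and <| hR.eventually self_mem_nhdsWithin)).exists
  have hρ : R w ≠ 0 := hw5
  obtain ⟨g0, -, g2⟩ := cauchyTransform_semicircleLaw_spec hw2
  have e1 := hc (1 / w)
  rw [hw1] at hw3
  rw [hw3] at e1
  rw [e1] at g0 g2
  have e2 := one_div_binomialParam hp hq n hρ
  rw [hw1] at e2
  rw [e2, add_div, add_comm] at g2
  have e3 : (s : ℂ) * binomialParam p q 0 (R w) = n * R w / s := by
    have : 1 / ((s : ℂ) * binomialParam p q 0 (R w)) = 1 / binomialParam p q 0 (R w) / s := by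
      rw [div_div, mul_comm]
    rw [this] at g2
    exact add_left_cancel g2
  have e4 : binomialParam p q 0 (R w) = p * q * R w := by
    rw [← hs2', eq_div_iff hs'] at e3
    have : (s : ℂ) ^ 2 * (binomialParam p q 0 (R w)) = s ^ 2 * (p * q * R w) := by
      linear_combination e3
    exact mul_left_cancel₀ (pow_ne_zero 2 hs') this
  have h0 : (p : ℂ) * q * R w ≠ 0 := mul_ne_zero (mul_ne_zero hp' hq') hρ
  rw [binomialParam] at e4
  have hD : (1 - ((q : ℂ) - p) * R w + (((0 : ℕ) : ℂ) - 1) * (p * q) * R w ^ 2) ≠ 0 := by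
    intro h
    rw [h, div_zero] at e4
    exact h0 e4.symm
  rw [div_eq_iff hD] at e4
  have e5 := mul_left_cancel₀ h0 ((mul_one _).trans e4)
  have e6 : R w * (((q : ℂ) - p) + p * q * R w) = 0 := by
    push_cast at e5
    linear_combination e5
  exact (mul_ne_zero hρ hw4) e6

theorem ae_normalizedPower_le {n : ℕ} (hn : 2 ≤ n)
    (h1 : 1 / (q * binomialRadius p q n) ≤ 1) (h2 : 1 / (p * binomialRadius p q n) ≤ 1)
    (h3 : |(q - p) / (p * q)| ≤ √(n / (p * q))) :
    ∀ᵐ t ∂normalizedPower p q n, t ≤ 3 := by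
  have hr := binomialRadius_pos hp hq hn
  have hrs := binomialRadius_le_sqrt_div hp hq n
  rw [normalizedPower_eq_map hp hq hpq hn]
  set r := binomialRadius p q n
  set s := √(n / (p * q))
  have hs : 0 < s := hr.trans_le hrs
  have e1 : |(-1) / (q * r)| ≤ 1 := by
    rwa [abs_div, abs_neg, abs_one, abs_of_pos (by positivity)]
  have e2 : |1 / (p * r)| ≤ 1 := by rwa [abs_of_pos (by positivity)]
  have hae : ∀ᵐ u ∂binomialMixture p q r, u ∈ Set.Icc (-2 : ℝ) 2 :=
    ae_mixture (ae_spikedSemicircle_mem_of_abs_le e1) (ae_spikedSemicircle_mem_of_abs_le e2)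
  refine (ae_map_iff (p := fun t => t ≤ 3) (by fun_prop) measurableSet_Iic).2 ?_
  filter_upwards [hae] with u hu
  rw [div_le_iff₀ hs]
  have := (abs_le.1 h3).1
  nlinarith [hu.2]

/-- At the point `1 / w + τ` the Cauchy transform of the rescaled `n`-th power has the value `w`.
The semicircle law has transform `G` with `G + 1 / G = z`, so that it would require `w = τ`. -/
theorem integral_one_div_sub_normalizedPower {n : ℕ} (hn : 2 ≤ n) {ρ τ w : ℝ} (hρ : 0 < ρ)
    (hτ : τ = p * q * √(n / (p * q)) * ρ) (hτ1 : τ < 1) (hqρ : q * ρ < 1)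
    (hw : w = τ / ((1 + p * ρ) * (1 - q * ρ))) (h2 : 2 < τ * (p * binomialRadius p q n)) :
    ∫ t, 1 / (1 / w + τ - t) ∂normalizedPower p q n = w := by
  have hr := binomialRadius_pos hp hq hn
  have hrs := binomialRadius_le_sqrt_div hp hq n
  have hs2 : √(n / (p * q)) ^ 2 = n / (p * q) := Real.sq_sqrt (by positivity)
  have hr2 := binomialRadius_sq hp hq (by omega : 1 ≤ n)
  have hc := cauchyTransform_normalizedPower hp hq hpq (by omega : 1 ≤ n)
  have hG := cauchyTransform_freeBinomial hp hq hpq hn (ρ := ρ)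
    (ζ := p * q * binomialRadius p q n * ρ)
  set r := binomialRadius p q n
  set s := √(n / (p * q))
  have hn2 : (2 : ℝ) ≤ n := by exact_mod_cast hn
  have hs : 0 < s := hr.trans_le hrs
  have hpos1 : 0 < 1 + p * ρ := by positivity
  have hpos2 : 0 < 1 - q * ρ := by linarith
  have hτ0 : 0 < τ := by rw [hτ]; positivity
  have hs2r : s ≤ 2 * r := by
    refine (pow_le_pow_iff_left₀ hs.le (by positivity) two_ne_zero).1 ?_
    rw [mul_pow, hs2, hr2, ← mul_div_assoc]
    gcongr
    linarith
  have hζ : p * q * r * ρ = τ * r / s := by rw [hτ]; field_simp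
  have hζle : p * q * r * ρ ≤ τ := by rw [hζ, div_le_iff₀ hs]; gcongr
  have hζ0 : 0 < p * q * r * ρ := by positivity
  -- the parameter `ζ` stays away from the poles at the (absent) atoms
  have hζge : 1 / (p * r) < p * q * r * ρ := by
    rw [hζ, div_lt_div_iff₀ (by positivity) hs]
    nlinarith
  have e0 := hG (by exact_mod_cast hρ.ne') rfl (by
      have : ‖((p * q * r * ρ : ℝ) : ℂ)‖ < 1 := by
        rw [Complex.norm_real, Real.norm_of_nonneg hζ0.le]; linarith
      exact_mod_cast this) (by exact_mod_cast hpos1.ne') (by exact_mod_cast hpos2.ne') (by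
      have : -1 / (q * r) - p * q * r * ρ ≠ 0 := by
        have : 0 < 1 / (q * r) := by positivity
        rw [neg_div]
        linarith
      exact_mod_cast this) (by
      have : 1 / (p * r) - p * q * r * ρ ≠ 0 := by linarith
      exact_mod_cast this)
  have e1 := hc (1 / binomialParam p q n ρ)
  rw [e0] at e1
  have hp' : (p : ℂ) ≠ 0 := by exact_mod_cast hp.ne'
  have hq' : (q : ℂ) ≠ 0 := by exact_mod_cast hq.ne'
  have hs' : (s : ℂ) ≠ 0 := by exact_mod_cast hs.ne'
  have hρ' : (ρ : ℂ) ≠ 0 := by exact_mod_cast hρ.ne'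
  have hpq' : (q : ℂ) = 1 - p := by
    rw [eq_sub_iff_add_eq, add_comm]; exact_mod_cast hpq
  have hD : 1 - ((q : ℂ) - p) * ρ + (((0 : ℕ) : ℂ) - 1) * (p * q) * (ρ : ℂ) ^ 2 =
      (1 + p * ρ) * (1 - q * ρ) := by rw [hpq']; push_cast; ring
  have hn' : (n : ℂ) = s ^ 2 * (p * q) := by
    rw [eq_div_iff (by positivity)] at hs2
    exact_mod_cast hs2.symm
  have e2 : 1 / binomialParam p q n ρ / s = ((1 / w + τ : ℝ) : ℂ) := by
    rw [one_div_binomialParam hp hq n hρ', binomialParam, hD, hn', hw, hτ]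
    push_cast
    simp only [one_div_div]
    field_simp
  have e3 : (s : ℂ) * binomialParam p q 0 ρ = (w : ℂ) := by
    rw [binomialParam, hD, hw, hτ]
    push_cast
    ring
  rw [e2, e3, cauchyTransform_ofReal] at e1
  exact_mod_cast e1

theorem exists_lower_bound (hne : p ≠ q) : ∃ c : ℝ, 0 < c ∧ ∀ᶠ n : ℕ in atTop,
    c ≤ kolmogorovDist (normalizedPower p q n) semicircleLaw * √n := by
  have hδ : 0 < |q - p| := abs_pos.2 (sub_ne_zero.2 hne.symm)
  have hδ1 : |q - p| ≤ 1 := abs_le.2 ⟨by linarith, by linarith⟩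
  have hk : 0 < √(p * q) := Real.sqrt_pos.2 (by positivity)
  have hk2 : √(p * q) ^ 2 = p * q := Real.sq_sqrt (by positivity)
  refine ⟨1 / 8 * |q - p| / (2 * 144 * 13 * √(p * q)), by positivity, ?_⟩
  -- `17 ≤ p √n` gives `2 < τ p r` for `τ = 1 / 8`, and `1 / 8 ≤ |q - p| / 4 * √(p q) * √n` says
  -- that the quadratic part of `η` is dominated by the linear one
  filter_upwards [eventually_ge_atTop 2, eventually_le_mul_sqrt 17 hp, eventually_le_mul_sqrt 1 hq,
    eventually_le_mul_sqrt |(q - p) / (p * q)| one_pos,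
    eventually_le_mul_sqrt (1 / 8) (by positivity : 0 < |q - p| / 4 * √(p * q))]
    with n hn hnp hnq hna hnρ
  have hr := binomialRadius_pos hp hq hn
  have hrs := binomialRadius_le_sqrt_div hp hq n
  have hnr := sqrt_le_binomialRadius hp hq hpq hn
  have hn0 : 0 < √(n : ℝ) := Real.sqrt_pos.2 (by positivity)
  have hsk : √(n / (p * q)) = √n / √(p * q) := Real.sqrt_div (by positivity) _
  have hpr : 17 ≤ p * binomialRadius p q n := hnp.trans (by gcongr)
  have hqr : 1 ≤ q * binomialRadius p q n := hnq.trans (by gcongr)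
  have hle := ae_normalizedPower_le hp hq hpq hn ((div_le_one (by positivity)).2 hqr)
    ((div_le_one (by positivity)).2 (by linarith)) (by linarith)
  have := isProbabilityMeasure_normalizedPower hp hq hpq n
  obtain ⟨ρ, hρ_def⟩ : ∃ ρ, ρ = 1 / 8 / (√(p * q) * √n) := ⟨_, rfl⟩
  have hρ : 0 < ρ := by rw [hρ_def]; positivity
  have hρle : ρ ≤ |q - p| / 4 := by
    rw [hρ_def, div_le_iff₀ (by positivity)]
    linarith
  have hτ : 1 / 8 = p * q * √(n / (p * q)) * ρ := by
    rw [hsk, hρ_def, ← hk2, Real.sqrt_sq hk.le]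
    field_simp
  obtain ⟨w, hw⟩ : ∃ w, w = 1 / 8 / ((1 + p * ρ) * (1 - q * ρ)) := ⟨_, rfl⟩
  have hI := integral_one_div_sub_normalizedPower hp hq hpq hn hρ hτ (by norm_num)
    (by nlinarith) hw (by linarith)
  -- `η` measures by how much `w` differs from `τ = 1 / 8`
  obtain ⟨η, hη⟩ : ∃ η, η = (q - p) * ρ + p * q * ρ ^ 2 := ⟨_, rfl⟩
  have hD : (1 + p * ρ) * (1 - q * ρ) = 1 - η := by
    rw [hη]; ring
  rw [hD] at hw
  have hpq4 : p * q ≤ 1 / 4 := by nlinarith [sq_nonneg (p - q)]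
  have hsq : p * q * ρ ^ 2 ≤ ρ * |q - p| / 16 := by nlinarith
  have hsq0 : 0 ≤ p * q * ρ ^ 2 := by positivity
  have habs : |(q - p) * ρ| = ρ * |q - p| := by rw [abs_mul, abs_of_pos hρ, mul_comm]
  have hη_le : |η| ≤ 1 / 2 := by
    rw [hη]
    refine (abs_add_le _ _).trans ?_
    rw [habs, abs_of_nonneg hsq0]
    nlinarith
  have hη_ge : ρ * |q - p| / 2 ≤ |η| := by
    have := abs_sub_abs_le_abs_sub ((q - p) * ρ) (-(p * q * ρ ^ 2))
    rw [sub_neg_eq_add, ← hη, habs, abs_neg, abs_of_nonneg hsq0] at this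
    nlinarith
  obtain ⟨-, hy1, -⟩ := transform_point_bounds hη_le hw
  have hsc : ∀ᵐ t ∂semicircleLaw, t ≤ 3 := ae_semicircleLaw_mem.mono fun t ht => by linarith [ht.2]
  have hd := abs_integral_sub_le_kolmogorovDist (by linarith : 3 < 1 / w + 1 / 8) hle hsc
  obtain ⟨g0, g1, g2⟩ := cauchyTransform_semicircleLaw_spec (z := ((1 / w + 1 / 8 : ℝ) : ℂ)) (by
    rw [Complex.norm_real, Real.norm_of_nonneg (by linarith)]; linarith)
  rw [cauchyTransform_ofReal] at g0 g1 g2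
  rw [hI] at hd
  have key := mul_abs_le_abs_sub hη_le hw (by exact_mod_cast g0)
    (by rwa [Complex.norm_real] at g1) (by exact_mod_cast g2)
  have hdist := hd.trans (div_le_self (kolmogorovDist_nonneg _ _) (by linarith))
  calc 1 / 8 * |q - p| / (2 * 144 * 13 * √(p * q))
      = (1 / 12) ^ 2 * (1 / 13) * (ρ * |q - p| / 2) * √n := by rw [hρ_def]; field_simp; norm_num
    _ ≤ (1 / 12) ^ 2 * (1 / 13) * |η| * √n := by gcongr
    _ ≤ _ := mul_le_mul_of_nonneg_right (key.trans hdist) hn0.le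

end

theorem exists_pos_le_of_eventually {f : ℕ → ℝ} {c : ℝ} (hc : 0 < c) (hf : ∀ n, 1 ≤ n → 0 < f n)
    (h : ∀ᶠ n in atTop, c ≤ f n) : ∃ c' : ℝ, 0 < c' ∧ ∀ n, 1 ≤ n → c' ≤ f n := by
  obtain ⟨N, hN⟩ := eventually_atTop.1 h
  have hne : (Finset.Icc 1 (N + 1)).Nonempty := ⟨1, by simp⟩
  refine ⟨min c ((Finset.Icc 1 (N + 1)).inf' hne f), lt_min hc ?_, fun n hn => ?_⟩
  · rw [Finset.lt_inf'_iff]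
    exact fun n hn => hf n (Finset.mem_Icc.1 hn).1
  · rcases le_total N n with h' | h'
    · exact (min_le_left _ _).trans (hN n h')
    · exact (min_le_right _ _).trans (Finset.inf'_le _ (Finset.mem_Icc.2 ⟨hn, by omega⟩))

theorem exists_le_of_eventually {f : ℕ → ℝ} {C : ℝ} (h : ∀ᶠ n in atTop, f n ≤ C) :
    ∃ C' : ℝ, 0 < C' ∧ ∀ n, f n ≤ C' := by
  obtain ⟨C', hC'⟩ := (isBoundedUnder_of_eventually_le h).bddAbove_range
  exact ⟨max C' 1, lt_max_of_lt_right one_pos, fun n => (hC' ⟨n, rfl⟩).trans (le_max_left _ _)⟩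

end FreeBerryEsseen

theorem mainTheorem2 (p q : ℝ) (hp : 0 < p) (hq : 0 < q) (hpq : p + q = 1) (hne : p ≠ q) :
    (∀ n : ℕ, ∃! ν : Measure ℝ, FreeBerryEsseen.IsFreeConvolution
        (FreeBerryEsseen.freeConvolutionPower (FreeBerryEsseen.twoPointMeasure p q) n)
        (FreeBerryEsseen.twoPointMeasure p q) ν) ∧
      ∃ C₁ C₂ : ℝ, 0 < C₁ ∧ 0 < C₂ ∧ ∀ n : ℕ, 1 ≤ n →
        C₁ * (n : ℝ) ^ (-(1 / 2) : ℝ) ≤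
            FreeBerryEsseen.kolmogorovDist (FreeBerryEsseen.normalizedPower p q n)
              FreeBerryEsseen.semicircleLaw ∧
          FreeBerryEsseen.kolmogorovDist (FreeBerryEsseen.normalizedPower p q n)
              FreeBerryEsseen.semicircleLaw ≤ C₂ * (n : ℝ) ^ (-(1 / 2) : ℝ) := by
  constructor
  · intro n
    rw [FreeBerryEsseen.freeConvolutionPower_eq_freeBinomial hp hq hpq]
    have h := FreeBerryEsseen.isFreeConvolution_freeBinomial_iff hp hq hpq n
    exact ⟨_, (h _).2 rfl, fun ν hν => (h ν).1 hν⟩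
  · obtain ⟨c, hc, hlow⟩ := FreeBerryEsseen.exists_lower_bound hp hq hpq hne
    obtain ⟨C, hup⟩ := FreeBerryEsseen.exists_upper_bound hp hq hpq
    obtain ⟨C₁, hC₁, h₁⟩ := FreeBerryEsseen.exists_pos_le_of_eventually hc (fun n hn =>
      mul_pos (FreeBerryEsseen.kolmogorovDist_normalizedPower_pos hp hq hpq hne hn)
        (Real.sqrt_pos.2 (by positivity))) hlow
    obtain ⟨C₂, hC₂, h₂⟩ := FreeBerryEsseen.exists_le_of_eventually hup
    refine ⟨C₁, C₂, hC₁, hC₂, fun n hn => ?_⟩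
    have hn0 : 0 < √(n : ℝ) := Real.sqrt_pos.2 (by positivity)
    have e : (n : ℝ) ^ (-(1 / 2) : ℝ) = 1 / √n := by
      rw [Real.rpow_neg (by positivity), ← Real.sqrt_eq_rpow, one_div]
    rw [e, mul_one_div, mul_one_div, div_le_iff₀ hn0, le_div_iff₀ hn0]
    exact ⟨h₁ n hn, h₂ n⟩
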